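/- **Setting.** For integers $m\ge 0$, $n\ge 1$, an environment is a map $E:\{0,\dots,m-1\}\times\mathbb Z_n\to\{0,1\}$, written $E_t(i)$, and a configuration is a map $\sigma:\mathbb Z_n\to\{0,1\}$. For a rule $\rho:\{0,1\}^3\to\{0,1\}$, $E$ *evolves according to* $\rho$ if $E_t(i)=\rho(E_{t-1}(i-1),E_{t-1}(i),E_{t-1}(i+1))$ for all $0<t<m$ and $i\in\mathbb Z_n$. It is *$\varepsilon$-far* from evolving according to $\rho$ if $|\{(t,i):E_t(i)\ne E'_t(i)\}|>\varepsilon mn$ for every $E'$ that evolves according to $\rho$. A rule $\rho$ is a *threshold rule* if for some $b\in\{0,\dots,3\}$ and $\alpha\in\{0,1\}$, $\rho(\beta_1,\beta_2,\beta_3)=\alpha$ if and only if $\beta_1+\beta_2+\beta_3\ge b$. Let $\mathrm{ddist}(i,j)\in\{0,\dots,n-1\}$ be the residue of $j-i$, $\mathrm{dist}(i,j)=\min\{\mathrm{ddist}(i,j),\mathrm{ddist}(j,i)\}$, and let $\mathrm{par}(x)\in\{0,1\}$ be the parity of $x$. A pair $(t,i)$ *descends* from $(t',i')$ if $t'<t$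 and $\mathrm{dist}(i,i')\le t-t'$. Write $\sigma(\Gamma_k(i))=\sigma(i-k)\cdots\sigma(i+k)\in\{0,1\}^{2k+1}$. **The conditions**, for a rule $\rho$, an integer $k\ge0$ and a partition $(F,\bar F)$ of $\{0,1\}^{2k+1}$ into final and non-final patterns. In 1–4, $E$ is any environment that evolves according to $\rho$, for any $m\ge 0$ and $n\ge1$. 1. If $E_t(\Gamma_k(i))\in F$ and $t+1<m$, then $E_{t+1}(\Gamma_k(i))\in F$. 2. If $E_t(\Gamma_k(i))\in\bar F$ and $t+1<m$, then $E_{t+1}(\Gamma_k(i))\in F$ if and only if $E_t(\Gamma_k(i-1))\in F$ or $E_t(\Gamma_k(i+1))\in F$. 3. There is a function $f:\{0,1\}^3\to\{0,1\}$, depending on $\rho$ only, which is the XOR of its first argument and a subset of the other two, such that: if $(t,i)$ descends from $(t',i')$, $E_t(\Gamma_k(i)),E_{t'}(\Gamma_k(i'))\in F$, and $E_{t'}(\Gamma_k(i''))\in\bar F$ for every $i''\ne i'$ with $\mathrm{dist}(i,i'')\le\mathrm{dist}(i,i')$, then $E_t(i)=f(E_{t'}(i'),\mathrm{par}(t-t'),\mathrm{par}(\mathrm{dist}(i,i')))$.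 4. For each $n\ge1$ there is $h:\bar F\times\{0,1\}\times\mathbb Z_n\to\bar F$ (independent of $m$ and $E$), with $h(\cdot,\beta,\ell)$ a bijection of $\bar F$ for all $\beta,\ell$, such that: if $(t,i)$ descends from $(t',i')$, $E_t(\Gamma_k(i)),E_{t'}(\Gamma_k(i'))\in\bar F$, and $E_{t'}(\Gamma_k(i''))\in\bar F$ for every $i''$ such that $(t,i)$ descends from $(t',i'')$, then $E_t(\Gamma_k(i))=h(E_{t'}(\Gamma_k(i')),\mathrm{par}(t-t'),\mathrm{ddist}(i',i))$. 5. Let $n\ge1$, let $\sigma$ be a configuration, and let $[x,y]=\{x,x+1,\dots,x+L\}$ with $0\le L\le n$ and $y=x+L$ (so $L=n$ is the case $y=x$ of going once around the cycle), with $\sigma(\Gamma_k(x)),\sigma(\Gamma_k(y))\in F$. Then there is a configuration $\tilde\sigma$, equal to $\sigma$ outside $[x,y]$, such that for every $i\in[x,y]$, $\tilde\sigma(\Gamma_k(i))\in F$, and $\tilde\sigma(i)=\sigma(i)$ if $\sigma(\Gamma_k(i))\in F$. 6. Let $n\ge 2$, let $\sigma$ be a configuration and $z\in\mathbb Z_n$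 with $\sigma(\Gamma_k(z))\in\bar F$, let $\nu$ be the middle bit of some pattern in $F$, and let $\gamma,\gamma'\in\{0,1\}$. Then there are a configuration $\tilde\sigma$ and $d\in\{1,\dots,2k+1\}$ such that, with $z'=z+d$: $\tilde\sigma(\Gamma_k(z'))\in F$; $f(\tilde\sigma(z'),\gamma,\mathrm{par}(d)\oplus\gamma')=\nu$ with the same $f$ as in 3; $\tilde\sigma(\Gamma_k(z+j))\in\bar F$ for $1\le j<d$; and $\tilde\sigma(i)=\sigma(i)$ for $i\notin\{z+k,\dots,z+k+d\}$. The mirror-image statement (with $z'=z-d$, $z-j$ and $\{z-k-d,\dots,z-k\}$) holds as well. **Statement.** Let $\mathrm{FIH}(\beta_1,\beta_2,\beta_3)=1-\beta_2$ if $\beta_1=\beta_2=\beta_3$ and $=\beta_2$ otherwise, and let $\mathrm{FUH}(\beta_1,\beta_2,\beta_3)=\beta_2$ if $\beta_1=\beta_2=\beta_3$ and $=1-\beta_2$ otherwise. For each rule $\rho\in\{\mathrm{FIH},\mathrm{FUH}\}$: * $\rho$ is not a threshold rule; * $\rho$ satisfies Conditions 1–6 with $k=1$ and non-final patterns $\bar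 F=\{000,111\}$; * evolution according to $\rho$ is testable with $O(1/\varepsilon^4)$ queries, non-adaptively and with one-sided error: there is a constant $C$ such that for all $m\ge0$, $n\ge1$ and $\varepsilon\in(0,1)$ there is a randomized algorithm that makes at most $C/\varepsilon^4$ queries to $E$, chosen before any answer is seen, accepts with probability $1$ every $E:\{0,\dots,m-1\}\times\mathbb Z_n\to\{0,1\}$ that evolves according to $\rho$, and rejects with probability at least $2/3$ every such $E$ that is $\varepsilon$-far from evolving according to $\rho$. -/

import Mathlib

/-! Elementary cellular automata on a cycle, the six conditions on local rules,
and one-sided-error non-adaptive testers for evolution according to a local rule. -/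

namespace EvolutionTesting

/-- A local rule `{0,1}³ → {0,1}`; its arguments are the left, centre and right bits. -/
abbrev Rule := Bool → Bool → Bool → Bool

/-- A configuration on the cycle of `n` locations. -/
abbrev Config (n : ℕ) := ZMod n → Bool

/-- An environment with time steps `0, …, m - 1` on the cycle of `n` locations. -/
abbrev Env (m n : ℕ) := Fin m → Config n

/-- `E` evolves according to the rule `ρ`. -/
def Evolves (ρ : Rule) {m n : ℕ} (E : Env m n) : Prop :=
  ∀ t t' : Fin m, t'.val = t.val + 1 →
    ∀ i : ZMod n, E t' i = ρ (E t (i - 1)) (E t i) (E t (i + 1))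

/-- `E` is `ε`-far from evolving according to `ρ`: it differs from every environment that evolves
according to `ρ` on more than `ε m n` time-location pairs. -/
def IsFar (ρ : Rule) {m n : ℕ} [NeZero n] (ε : ℝ) (E : Env m n) : Prop :=
  ∀ E' : Env m n, Evolves ρ E' →
    ε * m * n <
      ((Finset.univ.filter fun p : Fin m × ZMod n => E p.1 p.2 ≠ E' p.1 p.2).card : ℝ)

/-- Threshold rules: for some `0 ≤ b ≤ 3` and some bit `α`, the rule outputs `α` exactly when at
least `b` of its arguments are `1`. -/
def IsThreshold (ρ : Rule) : Prop :=
  ∃ b ≤ 3, ∃ α : Bool, ∀ x y z : Bool,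
    ρ x y z = α ↔ b ≤ x.toNat + y.toNat + z.toNat

/-- Flip if homogeneous. -/
def fih : Rule := fun x y z => if x = y ∧ y = z then !y else y

/-- Flip unless homogeneous. -/
def fuh : Rule := fun x y z => if x = y ∧ y = z then y else !y

/-! ### Distances, neighbourhoods and patterns -/

/-- The parity of a natural number, as a bit (`true` when odd). -/
def parity (x : ℕ) : Bool := decide (x % 2 = 1)

/-- The directed distance from `i` to `j`, a number in `{0, …, n - 1}`. -/
def ddist {n : ℕ} (i j : ZMod n) : ℕ := (j - i).val

/-- The undirected distance between `i` and `j` on the cycle. -/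
def cdist {n : ℕ} (i j : ZMod n) : ℕ := min (ddist i j) (ddist j i)

/-- The pair `(t, i)` descends from the pair `(t', i')`. -/
def Descends {m n : ℕ} (t : Fin m) (i : ZMod n) (t' : Fin m) (i' : ZMod n) : Prop :=
  t' < t ∧ cdist i i' ≤ t.val - t'.val

/-- Binary strings of length `2k + 1`. -/
abbrev Pattern (k : ℕ) := Fin (2 * k + 1) → Bool

/-- The pattern `σ(i - k), …, σ(i + k)` that `σ` has on the `k`-neighbourhood of `i`. -/
def nbhd {n : ℕ} (k : ℕ) (σ : Config n) (i : ZMod n) : Pattern k :=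
  fun j => σ (i - (k : ZMod n) + ((j : ℕ) : ZMod n))

/-- The middle bit of a pattern. -/
def middle {k : ℕ} (τ : Pattern k) : Bool := τ ⟨k, by omega⟩

/-! ### The conditions

`F` is the set of final `(2k+1)`-patterns; a pattern is non-final when it is not in `F`. -/

/-- Final locations remain final. -/
def Condition1 (ρ : Rule) (k : ℕ) (F : Set (Pattern k)) : Prop :=
  ∀ (m n : ℕ) [NeZero n] (E : Env m n), Evolves ρ E →
    ∀ t t' : Fin m, t'.val = t.val + 1 → ∀ i : ZMod n,
      nbhd k (E t) i ∈ F → nbhd k (E t') i ∈ F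

/-- A non-final location becomes final in one step iff it has a final neighbour. -/
def Condition2 (ρ : Rule) (k : ℕ) (F : Set (Pattern k)) : Prop :=
  ∀ (m n : ℕ) [NeZero n] (E : Env m n), Evolves ρ E →
    ∀ t t' : Fin m, t'.val = t.val + 1 → ∀ i : ZMod n, nbhd k (E t) i ∉ F →
      (nbhd k (E t') i ∈ F ↔ nbhd k (E t) (i - 1) ∈ F ∨ nbhd k (E t) (i + 1) ∈ F)

/-- `f` is the XOR of its first argument and a subset of the other two arguments. -/
def IsXorOfFirst (f : Bool → Bool → Bool → Bool) : Prop :=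
  ∃ c d : Bool, ∀ x y z : Bool, f x y z = xor x (xor (c && y) (d && z))

/-- The value at a final location is predicted, through `f`, by the closest final location at an
earlier time step from which it descends. -/
def Condition3 (ρ : Rule) (k : ℕ) (F : Set (Pattern k)) (f : Bool → Bool → Bool → Bool) : Prop :=
  IsXorOfFirst f ∧
  ∀ (m n : ℕ) [NeZero n] (E : Env m n), Evolves ρ E →
    ∀ (t t' : Fin m) (i i' : ZMod n), Descends t i t' i' →
      nbhd k (E t) i ∈ F → nbhd k (E t') i' ∈ F →
      (∀ i'' : ZMod n, i'' ≠ i' → cdist i i'' ≤ cdist i i' → nbhd k (E t') i'' ∉ F) →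
      E t i = f (E t' i') (parity (t.val - t'.val)) (parity (cdist i i'))

/-- The pattern at a non-final location is predicted, through a reversible `h`, by the pattern at
any earlier location from which it descends, when all its ancestors at that time are non-final. -/
def Condition4 (ρ : Rule) (k : ℕ) (F : Set (Pattern k)) : Prop :=
  ∀ (n : ℕ) [NeZero n],
    ∃ h : {τ : Pattern k // τ ∉ F} → Bool → ZMod n → {τ : Pattern k // τ ∉ F},
      (∀ (τ : {τ : Pattern k // τ ∉ F}) (β : Bool) (l : ZMod n), ∃! τ', h τ' β l = τ) ∧
      ∀ (m : ℕ) (E : Env m n), Evolves ρ E →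
        ∀ (t t' : Fin m) (i i' : ZMod n), Descends t i t' i' →
          ∀ (hi : nbhd k (E t) i ∉ F) (hi' : nbhd k (E t') i' ∉ F),
          (∀ i'' : ZMod n, Descends t i t' i'' → nbhd k (E t') i'' ∉ F) →
          (⟨nbhd k (E t) i, hi⟩ : {τ : Pattern k // τ ∉ F}) =
            h ⟨nbhd k (E t') i', hi'⟩ (parity (t.val - t'.val)) (i - i')

/-- An interval `[x, y] = {x, x + 1, …, x + L}`, `y = x + L`, with final endpoints can be made
completely final by changes inside it that keep the values at its final locations. The case
`L = n` is the one where `y = x` and the interval goes once around the cycle. -/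
def Condition5 (k : ℕ) (F : Set (Pattern k)) : Prop :=
  ∀ (n : ℕ) [NeZero n] (σ : Config n) (x : ZMod n) (L : ℕ), L ≤ n →
    nbhd k σ x ∈ F → nbhd k σ (x + (L : ZMod n)) ∈ F →
    ∃ σ' : Config n,
      (∀ i : ZMod n, (∀ j ≤ L, i ≠ x + (j : ZMod n)) → σ' i = σ i) ∧
      ∀ j ≤ L, nbhd k σ' (x + (j : ZMod n)) ∈ F ∧
        (nbhd k σ (x + (j : ZMod n)) ∈ F → σ' (x + (j : ZMod n)) = σ (x + (j : ZMod n)))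

/-- Next to a non-final location `z`, a final location `z' = z + d` (respectively, `z' = z - d`)
with `1 ≤ d ≤ 2k + 1` and a prescribed predicted value `ν` can be created by changes on
`[z + k, z' + k]` (respectively, on `[z' - k, z - k]`), so that all locations strictly between `z`
and `z'` are non-final. -/
def Condition6 (k : ℕ) (F : Set (Pattern k)) (f : Bool → Bool → Bool → Bool) : Prop :=
  ∀ (n : ℕ), 2 ≤ n → ∀ (σ : Config n) (z : ZMod n), nbhd k σ z ∉ F →
    ∀ ν ∈ middle '' F, ∀ γ γ' : Bool,
      (∃ (σ' : Config n) (d : ℕ), 1 ≤ d ∧ d ≤ 2 * k + 1 ∧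
        nbhd k σ' (z + (d : ZMod n)) ∈ F ∧
        f (σ' (z + (d : ZMod n))) γ (xor (parity d) γ') = ν ∧
        (∀ j : ℕ, 1 ≤ j → j < d → nbhd k σ' (z + (j : ZMod n)) ∉ F) ∧
        ∀ i : ZMod n, (∀ j ≤ d, i ≠ z + (k : ZMod n) + (j : ZMod n)) → σ' i = σ i) ∧
      (∃ (σ' : Config n) (d : ℕ), 1 ≤ d ∧ d ≤ 2 * k + 1 ∧
        nbhd k σ' (z - (d : ZMod n)) ∈ F ∧
        f (σ' (z - (d : ZMod n))) γ (xor (parity d) γ') = ν ∧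
        (∀ j : ℕ, 1 ≤ j → j < d → nbhd k σ' (z - (j : ZMod n)) ∉ F) ∧
        ∀ i : ZMod n, (∀ j ≤ d, i ≠ z - (k : ZMod n) - (j : ZMod n)) → σ' i = σ i)

/-- The rule `ρ` satisfies all six conditions, with respect to `k` and the final patterns `F`;
the prediction function `f` depends on the rule only and is shared by two of the conditions. -/
def SatisfiesConditions (ρ : Rule) (k : ℕ) (F : Set (Pattern k)) : Prop :=
  Condition1 ρ k F ∧ Condition2 ρ k F ∧ Condition4 ρ k F ∧ Condition5 k F ∧
    ∃ f : Bool → Bool → Bool → Bool, Condition3 ρ k F f ∧ Condition6 k F f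

/-- The set `{000, 111}` of homogeneous `3`-patterns. -/
def homogeneous : Set (Pattern 1) := {![false, false, false], ![true, true, true]}

/-! ### Testers -/

/-- A deterministic non-adaptive algorithm with query access to an environment: a set of queries
fixed in advance, and a decision (`true` for accept) as a function of the answers. As the queries
are fixed in advance, they can be made in order of time. -/
structure Strategy (m n : ℕ) where
  /-- the queried time-location pairs -/
  queries : Finset (Fin m × ZMod n)
  /-- the decision, given the answers to the queries -/
  decide : (queries → Bool) → Bool

/-- The outcome of running a strategy on an environment. -/
def Strategy.run {m n : ℕ} (S : Strategy m n) (E : Env m n) : Bool :=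
  S.decide fun p => E p.1.1 p.1.2

/-- A randomized non-adaptive algorithm (a probability distribution over deterministic ones) that
makes at most `q` queries and tests evolution according to `ρ` with one-sided error: environments
that evolve according to `ρ` are accepted with probability `1`, and environments that are
`ε`-far from evolving according to `ρ` are rejected with probability at least `2/3`. -/
def IsOneSidedTester (ρ : Rule) {m n : ℕ} [NeZero n] (ε q : ℝ) (T : PMF (Strategy m n)) : Prop :=
  (∀ S ∈ T.support, (S.queries.card : ℝ) ≤ q) ∧
  (∀ E : Env m n, Evolves ρ E → (T.map fun S => S.run E) true = 1) ∧
  (∀ E : Env m n, IsFar ρ ε E → 2 / 3 ≤ (T.map fun S => S.run E) false)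

/-- Evolution according to `ρ` is testable, non-adaptively and with one-sided error, with
`O(1/ε⁴)` queries; the constant depends neither on `ε` nor on the sizes `m` and `n`. -/
def Testable (ρ : Rule) : Prop :=
  ∃ C : ℝ, 0 < C ∧ ∀ (m n : ℕ) [NeZero n] (ε : ℝ), 0 < ε → ε < 1 →
    ∃ T : PMF (Strategy m n), IsOneSidedTester ρ ε (C / ε ^ 4) T

end EvolutionTesting

namespace EvolutionTesting

/-! Under `fih` an inhomogeneous site is frozen forever, and a site is homogeneous after a step iff
it and both its neighbours were so before (`hom_step`). Hence, on the integer line, a site at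
distance `d` from the closest inhomogeneous site flips exactly `d` times and then freezes
(`iterate_of_dist`). The cycle is reduced to the line by pulling back along `k ↦ x + k`
(`iterate_lift`). The dynamical conditions follow from this description, and `fuh` is conjugate to
`fih` through `twist`, which preserves homogeneity.

For testing, the algorithm rejects only if no evolving environment fits the answers, so
one-sidedness is automatic. It remains to find small query sets, one per pair, of which a fraction
`ε / 2` reject any `ε`-far environment (`testable_of_querySets`). If `ε² m` is bounded, the set
consists of the pair and its whole light cone at time `0`.

Otherwise take an even `t₁` of order `ε m` and `δ` of order `ε t₁`. After `t₁` steps of a genuine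
evolution every inhomogeneous site lies in an interval of `2 t₁ + 1` such sites, so a grid of
spacing `δ` finds all homogeneous blocks, with ends located up to `O(δ)`. The grid at time `t₁`,
together with the last row, where sites outside the blocks are frozen, determines one configuration
(`interpolate`). Its evolution from time `0` differs from a far `E` on more than `ε m n` pairs. If
the query set of such a pair does not reject, some evolving `E'` agrees with `E` on it. By
`iterate_eq_of_not_near`, `E'` then takes the predicted value at the pair, a contradiction unless
the pair is exceptional: earlier than `t₁`, near an end or the middle of a block, or near the time
at which the end of its block is first felt. Block ends visible to a non-rejecting set are preceded
by gaps of length `2 t₁`, so there are at most `n / (2 t₁)` per direction, and the exceptions make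
up at most a fraction `ε / 2` (`card_ne_le`). -/

/-! ### Iterating "flip if homogeneous" -/

/-- The site `a` and its two neighbours carry the same bit. -/
def Hom {A : Type*} [Ring A] (σ : A → Bool) (a : A) : Prop := σ (a - 1) = σ a ∧ σ a = σ (a + 1)

/-- One step of the rule "flip if homogeneous". -/
def step {A : Type*} [Ring A] (σ : A → Bool) : A → Bool :=
  fun a => fih (σ (a - 1)) (σ a) (σ (a + 1))

section Ring
variable {A : Type*} [Ring A]

theorem step_of_hom {σ : A → Bool} {a : A} (h : Hom σ a) : step σ a = !σ a := by
  simp [step, fih, h.1, ← h.2]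

theorem step_of_not_hom {σ : A → Bool} {a : A} (h : ¬ Hom σ a) : step σ a = σ a := by
  unfold Hom at h
  simp only [step, fih, if_neg h]

/-- Only five consecutive bits are involved, so this is a finite check. -/
theorem hom_step (σ : A → Bool) (a : A) :
    Hom (step σ) a ↔ Hom σ (a - 1) ∧ Hom σ a ∧ Hom σ (a + 1) := by
  simp only [Hom, step, fih, sub_add_cancel, add_sub_cancel_right]
  generalize σ (a - 1 - 1) = x1
  generalize σ (a - 1) = x2
  generalize σ a = x3
  generalize σ (a + 1) = x4
  generalize σ (a + 1 + 1) = x5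
  revert x1 x2 x3 x4 x5
  decide

theorem iterate_of_not_hom {σ : A → Bool} {a : A} (h : ¬ Hom σ a) (t : ℕ) :
    step^[t] σ a = σ a ∧ ¬ Hom (step^[t] σ) a := by
  induction t with
  | zero => exact ⟨rfl, h⟩
  | succ t ih =>
    rw [Function.iterate_succ_apply']
    refine ⟨(step_of_not_hom ih.2).trans ih.1, fun h' => ih.2 ((hom_step _ _).1 h').2.1⟩

/-- Pulling back along `k ↦ x + k` commutes with the evolution. -/
theorem step_comp_add (σ : A → Bool) (x : A) :
    (fun k : ℤ => step σ (x + k)) = step (fun k : ℤ => σ (x + k)) := by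
  funext k
  simp only [step, Int.cast_sub, Int.cast_add, Int.cast_one, add_sub_assoc, add_assoc]

theorem iterate_comp_add (σ : A → Bool) (x : A) (t : ℕ) :
    (fun k : ℤ => step^[t] σ (x + k)) = step^[t] (fun k : ℤ => σ (x + k)) := by
  induction t with
  | zero => rfl
  | succ t ih => rw [Function.iterate_succ_apply', Function.iterate_succ_apply', step_comp_add, ih]

theorem iterate_lift (σ : A → Bool) (x : A) (t : ℕ) (k : ℤ) :
    step^[t] σ (x + k) = step^[t] (fun k : ℤ => σ (x + k)) k :=
  congrFun (iterate_comp_add σ x t) k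

theorem iterate_lift_zero (σ : A → Bool) (x : A) (t : ℕ) :
    step^[t] σ x = step^[t] (fun k : ℤ => σ (x + k)) 0 := by
  simpa using iterate_lift σ x t 0

theorem hom_lift (σ : A → Bool) (x : A) (k : ℤ) :
    Hom (fun k : ℤ => σ (x + k)) k ↔ Hom σ (x + k) := by
  simp only [Hom, Int.cast_sub, Int.cast_add, Int.cast_one, add_sub_assoc, add_assoc]

end Ring

/-! ### Evolution on the integer line -/

/-- Iterating `hom_step` widens the window by one on each side per step: inhomogeneity spreads at
speed exactly one. -/
theorem hom_iterate (σ : ℤ → Bool) (t : ℕ) (k : ℤ) :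
    Hom (step^[t] σ) k ↔ ∀ j : ℤ, |j - k| ≤ t → Hom σ j := by
  induction t generalizing k with
  | zero =>
    simp only [Function.iterate_zero, id, CharP.cast_eq_zero, abs_nonpos_iff, sub_eq_zero]
    exact ⟨fun h j hj => hj ▸ h, fun h => h k rfl⟩
  | succ t ih =>
    rw [Function.iterate_succ_apply', hom_step, ih, ih, ih]
    constructor
    · rintro ⟨h1, h2, h3⟩ j hj
      by_cases c1 : |j - (k - 1)| ≤ t
      · exact h1 j c1
      by_cases c2 : |j - (k + 1)| ≤ t
      · exact h3 j c2
      apply h2; push_cast at hj; rw [abs_le] at *; omega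
    · intro h
      refine ⟨fun j hj => h j ?_, fun j hj => h j ?_, fun j hj => h j ?_⟩ <;>
      · push_cast; rw [abs_le] at *; omega

theorem parity_succ (t : ℕ) : parity (t + 1) = !parity t := by
  unfold parity
  rcases Nat.mod_two_eq_zero_or_one t with h | h <;> simp [Nat.add_mod, h]

/-- The light cone keeps the site homogeneous through the first `t` steps, so it flips at each of
them. -/
theorem iterate_of_hom {σ : ℤ → Bool} {t : ℕ} {k : ℤ} (h : ∀ j : ℤ, |j - k| < t → Hom σ j) :
    step^[t] σ k = xor (σ k) (parity t) := by
  induction t with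
  | zero => simp [parity]
  | succ t ih =>
    rw [Function.iterate_succ_apply', step_of_hom, ih, parity_succ]
    · simp
    · intro j hj; apply h; push_cast; linarith
    · rw [hom_iterate]; intro j hj; apply h; push_cast; omega

/-- A site at distance `d` from the closest inhomogeneous site flips `d` times and then stays. -/
theorem iterate_of_dist {σ : ℤ → Bool} {t d : ℕ} {k a : ℤ} (h : ∀ j : ℤ, |j - k| < d → Hom σ j)
    (ha : |a - k| = d) (hσ : ¬ Hom σ a) (ht : d ≤ t) :
    step^[t] σ k = xor (σ k) (parity d) ∧ ¬ Hom (step^[t] σ) k := by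
  obtain ⟨s, rfl⟩ := Nat.exists_eq_add_of_le ht
  have h1 : ¬ Hom (step^[d] σ) k := by
    rw [hom_iterate]; exact fun h' => hσ (h' a ha.le)
  have h2 := iterate_of_not_hom h1 s
  rw [← Function.iterate_add_apply, add_comm s d] at h2
  exact ⟨h2.1.trans (iterate_of_hom h), h2.2⟩

/-- Overlapping homogeneous triples chain equalities, which also reach one site beyond each end of
the block. -/
theorem const_of_hom {σ : ℤ → Bool} {a b : ℤ} (h : ∀ j, a ≤ j → j ≤ b → Hom σ j) :
    ∀ j, a - 1 ≤ j → j ≤ b + 1 → a ≤ b → σ j = σ a := by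
  intro j h1 h2 hab
  rcases h1.eq_or_lt with h1 | h1
  · rw [← h1]; exact (h a le_rfl hab).1
  have : ∀ k : ℕ, a + k ≤ b + 1 → σ (a + k) = σ a := by
    intro k
    induction k with
    | zero => simp
    | succ k ih =>
      intro hk; push_cast at hk
      rw [← ih (by omega)]
      have := (h (a + k) (by omega) (by omega)).2
      rw [this]; push_cast; ring_nf
  obtain ⟨k, hk⟩ := Int.eq_ofNat_of_zero_le (a := j - a) (by omega)
  have : σ (a + k) = σ a := this k (by omega)
  rwa [show a + (k:ℤ) = j by omega] at this

/-- Inhomogeneous sites come in intervals of radius the elapsed time. -/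
theorem exists_center {σ : ℤ → Bool} {t : ℕ} {y : ℤ} (h : ¬ Hom (step^[t] σ) y) :
    ∃ c : ℤ, |c - y| ≤ t ∧ ∀ z : ℤ, |z - c| ≤ t → ¬ Hom (step^[t] σ) z := by
  rw [hom_iterate] at h
  push Not at h
  obtain ⟨c, hc, hc'⟩ := h
  refine ⟨c, hc, fun z hz h' => hc' ?_⟩
  rw [hom_iterate] at h'
  exact h' c (by rwa [abs_sub_comm])

/-- The value at a site depends only on its past light cone. -/
theorem iterate_congr {σ σ' : ℤ → Bool} {t : ℕ} {k : ℤ}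
    (h : ∀ j : ℤ, |j - k| ≤ t → σ j = σ' j) : step^[t] σ k = step^[t] σ' k := by
  induction t generalizing k with
  | zero => exact h k (by simp)
  | succ t ih =>
    simp only [Function.iterate_succ_apply', step]
    rw [ih, ih, ih] <;>
    · intro j hj; apply h; push_cast; rw [abs_le] at *; omega

/-- Reflection of the line. -/
theorem hom_neg (σ : ℤ → Bool) (k : ℤ) : Hom (fun j => σ (-j)) k ↔ Hom σ (-k) := by
  simp only [Hom, neg_sub, neg_add]
  rw [show (1:ℤ) - k = -k + 1 by ring, show -k + -1 = -k - 1 by ring]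
  exact ⟨fun h => ⟨h.2.symm, h.1.symm⟩, fun h => ⟨h.2.symm, h.1.symm⟩⟩

theorem iterate_neg (σ : ℤ → Bool) (t : ℕ) :
    step^[t] (fun j => σ (-j)) = fun j => step^[t] σ (-j) := by
  induction t with
  | zero => rfl
  | succ t ih =>
    rw [Function.iterate_succ_apply', Function.iterate_succ_apply', ih]
    funext k
    by_cases h : Hom (step^[t] σ) (-k)
    · rw [step_of_hom h, step_of_hom ((hom_neg _ _).2 h)]
    · rw [step_of_not_hom h, step_of_not_hom (fun h' => h ((hom_neg _ _).1 h'))]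

/-! ### The conditions for the two rules -/

theorem nbhd_mem {n : ℕ} {σ : Config n} {i : ZMod n} :
    nbhd 1 σ i ∈ homogeneousᶜ ↔ ¬ Hom σ i := by
  have h : nbhd 1 σ i = ![σ (i - 1), σ i, σ (i + 1)] := by
    funext j
    fin_cases j
    · simp [nbhd]
    · simp [nbhd]
    · simp only [nbhd]
      show σ (i - ((1 : ℕ) : ZMod n) + ((2 : ℕ) : ZMod n)) = σ (i + 1)
      congr 1; push_cast; ring
  rw [h]
  simp only [homogeneous, Hom, Set.mem_compl_iff, Set.mem_insert_iff, Set.mem_singleton_iff]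
  generalize σ (i - 1) = x
  generalize σ i = y
  generalize σ (i + 1) = z
  revert x y z
  decide

theorem Evolves.eq_step {m n : ℕ} {E : Env m n} (h : Evolves fih E) {t t' : Fin m}
    (ht : t'.val = t.val + 1) : E t' = step (E t) :=
  funext fun i => h t t' ht i

theorem Evolves.eq_iterate {m n : ℕ} {E : Env m n} (h : Evolves fih E) {t t' : Fin m}
    {s : ℕ} (ht : t'.val = t.val + s) : E t' = step^[s] (E t) := by
  induction s generalizing t' with
  | zero =>
    rw [show t' = t from Fin.ext (by omega)]; rfl
  | succ s ih =>
    rw [Function.iterate_succ_apply',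
      ← ih (t' := ⟨t.val + s, by have := t'.isLt; omega⟩) rfl]
    exact h.eq_step (by simp only; omega)

theorem evolves_iterate {m n : ℕ} (σ : Config n) :
    Evolves fih (fun t : Fin m => step^[t.val] σ) := by
  intro t t' h i
  simp only [h, Function.iterate_succ_apply']
  rfl

/-- Flipping all the bits at odd times exchanges the two rules. -/
def twist {m n : ℕ} (E : Env m n) : Env m n := fun t i => xor (E t i) (parity t.val)

theorem fuh_xor (x y z b : Bool) : xor (fih (xor x b) (xor y b) (xor z b)) (!b) = fuh x y z := by
  revert x y z b; decide

theorem fih_xor (x y z b : Bool) : xor (fuh (xor x b) (xor y b) (xor z b)) (!b) = fih x y z := by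
  revert x y z b; decide

theorem Evolves.twist_fuh {m n : ℕ} {E : Env m n} (h : Evolves fuh E) : Evolves fih (twist E) := by
  intro t t' ht i
  simp only [twist, ht, parity_succ, h t t' ht i]
  rw [← fuh_xor _ _ _ (parity t.val)]
  simp

theorem Evolves.twist_fih {m n : ℕ} {E : Env m n} (h : Evolves fih E) : Evolves fuh (twist E) := by
  intro t t' ht i
  simp only [twist, ht, parity_succ, h t t' ht i]
  rw [← fih_xor _ _ _ (parity t.val)]
  simp

theorem hom_twist {m n : ℕ} {E : Env m n} {t : Fin m} {i : ZMod n} :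
    Hom (twist E t) i ↔ Hom (E t) i := by
  simp [Hom, twist]

/-- A threshold rule is symmetric in its arguments, but `001` and `010` have different images. -/
theorem not_isThreshold_fih : ¬ IsThreshold fih := by
  rintro ⟨b, -, α, h⟩
  have h1 := h false false true
  have h2 := h false true false
  have := h1.trans h2.symm
  revert this; cases α <;> decide

theorem not_isThreshold_fuh : ¬ IsThreshold fuh := by
  rintro ⟨b, -, α, h⟩
  have h1 := h false false true
  have h2 := h false true false
  have := h1.trans h2.symm
  revert this; cases α <;> decide

theorem condition1_fih : Condition1 fih 1 homogeneousᶜ := by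
  intro m n _ E hE t t' ht i
  rw [nbhd_mem, nbhd_mem, hE.eq_step ht, hom_step]
  tauto

theorem condition1_fuh : Condition1 fuh 1 homogeneousᶜ := by
  intro m n _ E hE t t' ht i
  have := condition1_fih m n _ hE.twist_fuh t t' ht i
  rwa [nbhd_mem, nbhd_mem, hom_twist, hom_twist, ← nbhd_mem, ← nbhd_mem] at this

theorem condition2_fih : Condition2 fih 1 homogeneousᶜ := by
  intro m n _ E hE t t' ht i
  rw [nbhd_mem, nbhd_mem, nbhd_mem, nbhd_mem, hE.eq_step ht, hom_step]
  tauto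

theorem condition2_fuh : Condition2 fuh 1 homogeneousᶜ := by
  intro m n _ E hE t t' ht i
  have := condition2_fih m n _ hE.twist_fuh t t' ht i
  simpa only [nbhd_mem, hom_twist] using this

/-! ### Cycle distances and their integer lifts -/

section Distance
variable {n : ℕ}

theorem ddist_add_natCast_le (i : ZMod n) (d : ℕ) : ddist i (i + d) ≤ d := by
  rw [ddist, add_sub_cancel_left, ZMod.val_natCast]
  exact Nat.mod_le _ _

theorem cdist_add_le (i : ZMod n) (j : ℤ) : cdist i (i + j) ≤ j.natAbs := by
  obtain ⟨d, rfl | rfl⟩ := Int.eq_nat_or_neg j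
  · rw [Int.natAbs_natCast, Int.cast_natCast]
    exact (min_le_left _ _).trans (ddist_add_natCast_le _ _)
  · rw [Int.natAbs_neg, Int.natAbs_natCast]
    refine (min_le_right _ _).trans ?_
    have := ddist_add_natCast_le (i + ((-(d : ℤ) : ℤ) : ZMod n)) d
    rw [Int.cast_neg, Int.cast_natCast, neg_add_cancel_right] at this
    rwa [Int.cast_neg, Int.cast_natCast]

theorem exists_cdist [NeZero n] (i i' : ZMod n) :
    ∃ j : ℤ, j.natAbs = cdist i i' ∧ i' = i + j := by
  rcases min_choice (ddist i i') (ddist i' i) with h | h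
  · refine ⟨(ddist i i' : ℕ), ?_, ?_⟩
    · rw [cdist, h]; simp
    · simp [ddist]
  · refine ⟨-(ddist i' i : ℕ), ?_, ?_⟩
    · rw [cdist, h]; simp
    · simp [ddist]

end Distance

/-- A site next to a block of homogeneous sites carries the same bit as the block. -/
theorem eq_of_hom {σ : ℤ → Bool} {k a : ℤ} (h : ∀ j : ℤ, |j - k| < |a - k| → Hom σ j) :
    σ a = σ k := by
  rcases lt_trichotomy a k with hak | rfl | hak
  · have := const_of_hom (σ := σ) (a := a + 1) (b := k)
      (fun j h1 h2 => h j (by rw [abs_of_nonpos, abs_of_nonpos] <;> omega))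
    rw [this a (by omega) (by omega) (by omega), this k (by omega) (by omega) (by omega)]
  · rfl
  · exact const_of_hom (σ := σ) (a := k) (b := a - 1)
      (fun j h1 h2 => h j (by rw [abs_of_nonneg, abs_of_nonneg] <;> omega))
      a (by omega) (by omega) (by omega)

/-- On the line centred at `i`, the lift of `i'` is the closest inhomogeneous site. The bit at `i`
flips once per unit of distance to it, and initially equals the bit at `i'` because all sites in
between are homogeneous. -/
theorem condition3_fih : Condition3 fih 1 homogeneousᶜ (fun x _ z => xor x z) := by
  refine ⟨⟨false, true, by simp⟩, ?_⟩
  intro m n _ E hE t t' i i' ⟨htt, hd⟩ hi hi' hcl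
  rw [nbhd_mem] at hi hi'
  simp only [nbhd_mem, not_not] at hcl
  obtain ⟨j, hj, rfl⟩ := exists_cdist i i'
  rw [← hj] at hd hcl ⊢
  rw [hE.eq_iterate (t := t') (t' := t) (s := t.val - t'.val)
    (by have : t'.val < t.val := htt; omega), iterate_lift_zero]
  have hcl' : ∀ k : ℤ, |k - 0| < |j - 0| → Hom (fun k : ℤ => E t' (i + k)) k := by
    intro k hk
    rw [sub_zero, sub_zero, Int.abs_eq_natAbs, Int.abs_eq_natAbs] at hk
    rw [hom_lift]
    -- A lift strictly closer than `j` cannot represent `i'`, since `cdist` is bounded by the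
    -- absolute value of any lift.
    refine hcl _ (fun h' => ?_) ((cdist_add_le i k).trans (by omega))
    have := cdist_add_le i k
    rw [h', ← hj] at this; omega
  have h1 := (iterate_of_dist (d := j.natAbs) (t := t.val - t'.val) (a := j) (k := 0)
    (fun k hk => hcl' k (by rwa [sub_zero j, Int.abs_eq_natAbs j])) (by simp)
    (by rwa [hom_lift]) hd).1
  rw [h1, ← eq_of_hom hcl']

theorem parity_sub_xor {s t : ℕ} (h : s ≤ t) : parity t = xor (parity (t - s)) (parity s) := by
  obtain ⟨r, rfl⟩ := Nat.exists_eq_add_of_le h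
  rw [Nat.add_sub_cancel_left]
  unfold parity
  rcases Nat.mod_two_eq_zero_or_one s with h1 | h1 <;>
  rcases Nat.mod_two_eq_zero_or_one r with h2 | h2 <;> simp [Nat.add_mod, h1, h2]

theorem condition3_fuh : Condition3 fuh 1 homogeneousᶜ (fun x y z => xor x (xor y z)) := by
  refine ⟨⟨true, true, by simp⟩, ?_⟩
  intro m n _ E hE t t' i i' hd hi hi' hcl
  have h := condition3_fih.2 m n _ hE.twist_fuh t t' i i' hd
    (by rwa [nbhd_mem, hom_twist, ← nbhd_mem]) (by rwa [nbhd_mem, hom_twist, ← nbhd_mem])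
    (by simpa only [nbhd_mem, hom_twist] using hcl)
  have hp := parity_sub_xor (show t'.val ≤ t.val from hd.1.le)
  simp only [twist, hp] at h
  generalize parity t'.val = a at *
  generalize parity (t.val - t'.val) = b at *
  generalize parity (cdist i i') = c at *
  generalize E t i = x at *
  generalize E t' i' = y at *
  clear hp; revert h; revert a b c x y; decide

/-- Flip all bits of a non-final pattern when `β` is set. -/
def flipPattern (β : Bool) (τ : {τ : Pattern 1 // τ ∉ homogeneousᶜ}) :
    {τ : Pattern 1 // τ ∉ homogeneousᶜ} :=
  ⟨fun j => xor (τ.1 j) β, by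
    obtain ⟨τ, hτ⟩ := τ
    rw [Set.notMem_compl_iff] at hτ ⊢
    rcases hτ with rfl | rfl <;> cases β
    · left; funext j; fin_cases j <;> rfl
    · right; funext j; fin_cases j <;> rfl
    · right; funext j; fin_cases j <;> rfl
    · left; funext j; fin_cases j <;> rfl⟩

theorem flipPattern_flipPattern (β : Bool) (τ : {τ : Pattern 1 // τ ∉ homogeneousᶜ}) :
    flipPattern β (flipPattern β τ) = τ := by
  apply Subtype.ext; funext j; simp [flipPattern]

/-- The pattern at a non-final location is determined by the pattern at a non-final ancestor,
provided that all ancestors are non-final. -/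
theorem nbhd_eq_of_ancestors_hom {m n : ℕ} {E : Env m n} (hE : Evolves fih E)
    {t t' : Fin m} {i i' : ZMod n} [NeZero n] (hd : Descends t i t' i')
    (hcl : ∀ i'' : ZMod n, Descends t i t' i'' → Hom (E t') i'') (j : Fin (2 * 1 + 1)) :
    nbhd 1 (E t) i j = xor (nbhd 1 (E t') i' j) (parity (t.val - t'.val)) := by
  obtain ⟨l, hl, rfl⟩ := exists_cdist i i'
  have hlt := hd.2
  rw [← hl] at hlt
  have hh : ∀ k : ℤ, |k| ≤ (t.val - t'.val : ℕ) → Hom (fun k : ℤ => E t' (i + k)) k := by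
    intro k hk
    rw [hom_lift]
    exact hcl _ ⟨hd.1, (cdist_add_le i k).trans (by rw [Int.abs_eq_natAbs] at hk; omega)⟩
  have hconst : ∀ k : ℤ, |k| ≤ (t.val - t'.val : ℕ) + 1 → E t' (i + k) = E t' i := by
    intro k hk
    have h1 := const_of_hom (σ := fun k : ℤ => E t' (i + k))
      (a := -((t.val - t'.val : ℕ) : ℤ)) (b := (t.val - t'.val : ℕ))
      (fun j h1 h2 => hh j (abs_le.2 ⟨h1, h2⟩))
    rw [abs_le] at hk
    have h2 := h1 k (by omega) (by omega) (by omega)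
    have h3 := h1 0 (by omega) (by omega) (by omega)
    simp only [Int.cast_zero, add_zero] at h2 h3
    rw [h2, h3]
  have hEt : E t = step^[t.val - t'.val] (E t') :=
    hE.eq_iterate (by have : t'.val < t.val := hd.1; omega)
  have htt : 1 ≤ t.val - t'.val := by have : t'.val < t.val := hd.1; omega
  have key : ∀ k : ℤ, |k| ≤ 1 → E t (i + k) = xor (E t' i) (parity (t.val - t'.val)) := by
    intro k hk
    rw [hEt, iterate_lift]
    have h0 := iterate_of_hom (σ := fun k : ℤ => E t' (i + k)) (k := k) (t := t.val - t'.val)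
      (fun j hj => hh j (by rw [abs_lt] at hj; rw [abs_le] at *; omega))
    rw [h0, hconst k (hk.trans (by omega))]
  have hj : |(j : ℤ) - 1| ≤ 1 := by rw [abs_le]; omega
  have e1 : ∀ x : ZMod n, x - ((1 : ℕ) : ZMod n) + ((j : ℕ) : ZMod n)
      = x + (((j : ℤ) - 1 : ℤ) : ZMod n) := by intro x; push_cast; ring
  simp only [nbhd, e1]
  rw [key _ hj, add_assoc, ← Int.cast_add, hconst]
  rw [abs_le] at *; omega

theorem condition4_fih : Condition4 fih 1 homogeneousᶜ := by
  intro n _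
  refine ⟨fun τ β _ => flipPattern β τ, fun τ β l => ⟨flipPattern β τ,
    flipPattern_flipPattern β τ, fun τ' h => by rw [← h, flipPattern_flipPattern]⟩, ?_⟩
  intro m E hE t t' i i' hd hi hi' hcl
  apply Subtype.ext; funext j
  refine nbhd_eq_of_ancestors_hom hE hd (fun i'' h => ?_) j
  have := hcl i'' h
  rwa [nbhd_mem, not_not] at this

/-- The flips of `fih` are cancelled by `twist`, so homogeneous patterns persist and `h` is the
identity in the pattern. -/
theorem condition4_fuh : Condition4 fuh 1 homogeneousᶜ := by
  intro n _
  refine ⟨fun τ _ _ => τ, fun τ β l => ⟨τ, rfl, fun τ' h => h⟩, ?_⟩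
  intro m E hE t t' i i' hd hi hi' hcl
  apply Subtype.ext; funext j
  have h := nbhd_eq_of_ancestors_hom hE.twist_fuh hd (fun i'' h => by
    have := hcl i'' h
    rwa [nbhd_mem, not_not, ← hom_twist] at this) j
  have hp := parity_sub_xor (show t'.val ≤ t.val from hd.1.le)
  simp only [nbhd, twist, hp] at h ⊢
  generalize parity t'.val = a at *
  generalize parity (t.val - t'.val) = b at *
  generalize E t _ = x at *
  generalize E t' _ = y at *
  clear hp; revert h; revert a b x y; decide

/-- Flipping each bit according to the parity of its distance to the nearest inhomogeneous site on
its left turns constant blocks into alternating ones and leaves inhomogeneous sites unchanged. -/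
theorem condition5_homogeneous : Condition5 1 homogeneousᶜ := by
  classical
  intro n _ σ x L _ hx _
  rw [nbhd_mem] at hx
  have hex : ∀ i : ZMod n, ∃ j : ℕ, ¬ Hom σ (i - j) := fun i => ⟨(i - x).val, by simpa using hx⟩
  let d : ZMod n → ℕ := fun i => Nat.find (hex i)
  have hd0 : ∀ i, ¬ Hom σ i → d i = 0 := fun i hi => by
    simp only [d, Nat.find_eq_zero]; simpa using hi
  have hds : ∀ i, Hom σ i → d i = d (i - 1) + 1 := fun i hi => by
    simp only [d]
    rw [Nat.find_comp_succ (hex i) (by simpa [sub_sub, add_comm] using hex (i - 1)) (by simpa using hi)]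
    congr 2
    funext j; push_cast; rw [sub_sub, add_comm]
  let σ' : Config n := fun i => if ∃ j ≤ L, i = x + (j : ℕ) then xor (σ i) (parity (d i)) else σ i
  have hfin : ∀ i, ¬ Hom σ i → σ' i = σ i := fun i hi => by
    simp [σ', hd0 i hi, parity]
  refine ⟨σ', fun i hi => if_neg (by push Not; exact hi), fun j hj => ⟨?_, fun h => ?_⟩⟩
  · rw [nbhd_mem]
    intro h
    by_cases hi : Hom σ (x + (j : ℕ))
    · obtain ⟨j, rfl⟩ : ∃ k, j = k + 1 :=
        Nat.exists_eq_succ_of_ne_zero (by rintro rfl; simp [hx] at hi)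
      have e : x + ((j + 1 : ℕ) : ZMod n) - 1 = x + (j : ℕ) := by push_cast; ring
      have h1 : σ' (x + (j + 1 : ℕ)) = xor (σ (x + (j + 1 : ℕ))) (parity (d (x + (j + 1 : ℕ)))) :=
        if_pos ⟨_, hj, rfl⟩
      have h2 : σ' (x + (j : ℕ)) = xor (σ (x + (j : ℕ))) (parity (d (x + (j : ℕ)))) :=
        if_pos ⟨_, by omega, rfl⟩
      have h3 := h.1
      have h4 := hi.1
      rw [e] at h3 h4
      rw [h1, h2, hds _ hi, e, parity_succ, h4] at h3
      simp at h3
    · apply hi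
      have h0 := hfin _ hi
      -- If a neighbour's bit differs from that of this site, the neighbour is inhomogeneous as
      -- well, so both bits survive the change and still differ.
      have hl : σ (x + (j : ℕ) - 1) = σ (x + (j : ℕ)) := by
        by_contra hne
        have : ¬ Hom σ (x + (j : ℕ) - 1) := fun h' => hne (by simpa using h'.2)
        exact hne (by rw [← hfin _ this, h.1, h0])
      have hr : σ (x + (j : ℕ)) = σ (x + (j : ℕ) + 1) := by
        by_contra hne
        have : ¬ Hom σ (x + (j : ℕ) + 1) := fun h' => hne (by simpa using h'.1)
        exact hne (by rw [← hfin _ this, ← h.2, h0])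
      exact ⟨hl, hr⟩
  · rw [nbhd_mem] at h
    exact hfin _ h

/-- Distance `d = 1` always works: put a suitable bit next to `z` and its negation one site further.
The bit exists because `f` is a bijection in its first argument. -/
theorem condition6_of_isXorOfFirst {f : Bool → Bool → Bool → Bool} (hf : IsXorOfFirst f) :
    Condition6 1 homogeneousᶜ f := by
  obtain ⟨c, d, hf⟩ := hf
  intro n hn σ z _ ν _ γ γ'
  have : Fact (1 < n) := ⟨hn⟩
  obtain ⟨b, hb⟩ : ∃ b, f b γ (xor (parity 1) γ') = ν := by
    refine ⟨xor ν (xor (c && γ) (d && xor (parity 1) γ')), ?_⟩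
    rw [hf, Bool.xor_assoc, Bool.xor_self, Bool.xor_false]
  have hne : ∀ s : ZMod n, s = 1 ∨ s = -1 → z + s + s ≠ z + s := by
    rintro s (rfl | rfl) h <;> simp at h
  have main : ∀ s : ZMod n, s = 1 ∨ s = -1 → ∃ σ' : Config n,
      ¬ Hom σ' (z + s) ∧ σ' (z + s) = b ∧ ∀ i, i ≠ z + s → i ≠ z + s + s → σ' i = σ i := by
    intro s hs
    refine ⟨Function.update (Function.update σ (z + s + s) (!b)) (z + s) b, ?_, by simp, ?_⟩
    · intro h
      have h1 : Function.update (Function.update σ (z + s + s) (!b)) (z + s) b (z + s + s) = !b := by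
        rw [Function.update_of_ne (hne s hs), Function.update_self]
      have h2 : Function.update (Function.update σ (z + s + s) (!b)) (z + s) b (z + s) = b := by
        simp
      rcases hs with rfl | rfl
      · have := h.2; rw [h1, h2] at this; simp at this
      · have := h.1; rw [sub_eq_add_neg, h1, h2] at this; simp at this
    · intro i h1 h2
      rw [Function.update_of_ne h1, Function.update_of_ne h2]
  constructor
  · obtain ⟨σ', h1, h2, h3⟩ := main 1 (Or.inl rfl)
    refine ⟨σ', 1, le_rfl, by norm_num, by rwa [nbhd_mem, Nat.cast_one], by rw [Nat.cast_one, h2, hb],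
      fun j h1 h2 => by omega, fun i hi => h3 i ?_ ?_⟩
    · simpa using hi 0 (by norm_num)
    · simpa using hi 1 le_rfl
  · obtain ⟨σ', h1, h2, h3⟩ := main (-1) (Or.inr rfl)
    rw [← sub_eq_add_neg] at h1 h2
    refine ⟨σ', 1, le_rfl, by norm_num, by rwa [nbhd_mem, Nat.cast_one], by rw [Nat.cast_one, h2, hb],
      fun j h1 h2 => by omega, fun i hi => h3 i ?_ ?_⟩
    · simpa [← sub_eq_add_neg] using hi 0 (by norm_num)
    · simpa [← sub_eq_add_neg] using hi 1 le_rfl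

theorem satisfiesConditions_fih : SatisfiesConditions fih 1 homogeneousᶜ :=
  ⟨condition1_fih, condition2_fih, condition4_fih, condition5_homogeneous, _, condition3_fih,
    condition6_of_isXorOfFirst condition3_fih.1⟩

theorem satisfiesConditions_fuh : SatisfiesConditions fuh 1 homogeneousᶜ :=
  ⟨condition1_fuh, condition2_fuh, condition4_fuh, condition5_homogeneous, _, condition3_fuh,
    condition6_of_isXorOfFirst condition3_fuh.1⟩

/-! ### Testers from distributions on query sets -/

/-- The answers to the queries in `Q` rule out that the environment evolves according to `ρ`. -/
def Rejects (ρ : Rule) {m n : ℕ} (Q : Finset (Fin m × ZMod n)) (E : Env m n) : Prop :=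
  ∀ E' : Env m n, Evolves ρ E' → ∃ p ∈ Q, E' p.1 p.2 ≠ E p.1 p.2

theorem Rejects.mono {ρ : Rule} {m n : ℕ} {Q Q' : Finset (Fin m × ZMod n)} {E : Env m n}
    (h : Rejects ρ Q E) (hQ : Q ⊆ Q') : Rejects ρ Q' E := fun E' hE' =>
  let ⟨p, hp, hne⟩ := h E' hE'
  ⟨p, hQ hp, hne⟩

open Classical in
/-- The strategy that rejects only when the answers leave no other choice. -/
noncomputable def canonicalStrategy (ρ : Rule) {m n : ℕ} (Q : Finset (Fin m × ZMod n)) :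
    Strategy m n where
  queries := Q
  decide := fun a => decide (∃ E' : Env m n, Evolves ρ E' ∧ ∀ p : Q, E' p.1.1 p.1.2 = a p)

theorem run_canonicalStrategy_of_evolves {ρ : Rule} {m n : ℕ} (Q : Finset (Fin m × ZMod n))
    {E : Env m n} (hE : Evolves ρ E) : (canonicalStrategy ρ Q).run E = true := by
  simp only [Strategy.run, canonicalStrategy, decide_eq_true_eq]
  exact ⟨E, hE, fun _ => rfl⟩

theorem run_canonicalStrategy_of_rejects {ρ : Rule} {m n : ℕ} {Q : Finset (Fin m × ZMod n)}
    {E : Env m n} (h : Rejects ρ Q E) : (canonicalStrategy ρ Q).run E = false := by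
  simp only [Strategy.run, canonicalStrategy, decide_eq_false_iff_not]
  rintro ⟨E', hE', hag⟩
  obtain ⟨p, hp, hne⟩ := h E' hE'
  exact hne (hag ⟨p, hp⟩)

theorem map_const_apply {α : Type*} (T : PMF α) (f : α → Bool) (b : Bool) (h : ∀ a, f a = b) :
    (T.map f) b = 1 := by
  rw [show f = Function.const α b from funext h, PMF.map_const]
  simp

/-- Independent uniform trials: if each trial succeeds with probability at least `x`, then
`r ≥ 2 / x` trials contain a success with probability at least `2 / 3`. -/
theorem two_thirds_le_map_uniform {α : Type*} [Fintype α] [Nonempty α] (B : Finset α) (x : ℝ)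
    (hB : x * Fintype.card α ≤ B.card) (r : ℕ) (hr : 2 ≤ x * r)
    (f : (Fin r → α) → Bool) (hf : ∀ s, (∃ j, s j ∈ B) → f s = false) :
    2 / 3 ≤ ((PMF.uniformOfFintype (Fin r → α)).map f) false := by
  classical
  set N : ℝ := (Fintype.card α : ℝ) with hN
  have hNpos : 0 < N := by rw [hN]; exact_mod_cast Fintype.card_pos
  -- the tuples without success
  set M : Finset (Fin r → α) := Fintype.piFinset fun _ => Bᶜ with hM
  have hMcard : (M.card : ℝ) ≤ N ^ r / 3 := by
    have h1 : (M.card : ℝ) = (N - B.card) ^ r := by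
      rw [hM, Fintype.card_piFinset_const, Finset.card_compl, Nat.cast_pow,
        Nat.cast_sub (Finset.card_le_univ B)]
    have hBN : (B.card : ℝ) ≤ N := by rw [hN]; exact_mod_cast Finset.card_le_univ B
    -- This is `1 - x ≤ exp (-x)`; the failure probability is then at most `exp (-x r) ≤ exp (-2) ≤
    -- 1 / 3`.
    have h2 : (N - B.card) ≤ N * Real.exp (-x) := by
      have := Real.add_one_le_exp (-x)
      nlinarith
    have h3 : Real.exp (-x) ^ r ≤ 1 / 3 := by
      rw [← Real.exp_nat_mul]
      have h4 : (3 : ℝ) ≤ Real.exp 2 := by have := Real.add_one_le_exp 2; linarith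
      calc Real.exp (r * -x) ≤ Real.exp (-2) := Real.exp_le_exp.2 (by linarith)
        _ = 1 / Real.exp 2 := by rw [Real.exp_neg, one_div]
        _ ≤ 1 / 3 := one_div_le_one_div_of_le (by norm_num) h4
    calc (M.card : ℝ) ≤ (N * Real.exp (-x)) ^ r := by
          rw [h1]; exact pow_le_pow_left₀ (by linarith) h2 r
      _ = N ^ r * Real.exp (-x) ^ r := mul_pow _ _ _
      _ ≤ N ^ r * (1 / 3) := by gcongr
      _ = N ^ r / 3 := by ring
  have hsub : Mᶜ ⊆ Finset.univ.filter fun s => f s = false := by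
    intro s hs
    simp only [hM, Finset.mem_compl, Fintype.mem_piFinset, not_forall, not_not] at hs
    simpa using hf s hs
  have hcard : (Fintype.card (Fin r → α) : ℝ) = N ^ r := by simp [hN]
  have hbig : 2 / 3 * N ^ r ≤ ((Finset.univ.filter fun s => f s = false).card : ℝ) := by
    have h1 : (Mᶜ.card : ℝ) = N ^ r - M.card := by
      rw [Finset.card_compl, Nat.cast_sub (Finset.card_le_univ M), hcard]
    have h2 : (Mᶜ.card : ℝ) ≤ ((Finset.univ.filter fun s => f s = false).card : ℝ) := by
      exact_mod_cast Finset.card_le_card hsub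
    linarith
  rw [PMF.map_apply, tsum_fintype]
  simp only [PMF.uniformOfFintype_apply, eq_comm (a := false)]
  rw [← Finset.sum_filter, Finset.sum_const, nsmul_eq_mul]
  have hc0 : (Fintype.card (Fin r → α) : ENNReal) ≠ 0 := by
    exact_mod_cast Fintype.card_ne_zero
  rw [← div_eq_mul_inv, ENNReal.le_div_iff_mul_le (Or.inl hc0) (Or.inl (ENNReal.natCast_ne_top _))]
  rw [← ENNReal.ofReal_natCast, ← ENNReal.ofReal_natCast, hcard,
    show (2 / 3 : ENNReal) = ENNReal.ofReal (2 / 3) by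
      rw [ENNReal.ofReal_div_of_pos (by norm_num)]; simp,
    ← ENNReal.ofReal_mul (by norm_num)]
  exact ENNReal.ofReal_le_ofReal hbig

/-- A rule is testable when there are small query sets, indexed by the time-location pairs, a
constant fraction of `ε` of which rejects any given environment that is `ε`-far. -/
theorem testable_of_querySets {ρ : Rule} {C : ℝ} (hC : 0 < C)
    (h : ∀ (m n : ℕ) [NeZero n] (ε : ℝ), 0 < ε → ε < 1 →
      ∃ Q : Fin m × ZMod n → Finset (Fin m × ZMod n), (∀ p, ((Q p).card : ℝ) ≤ C / ε ^ 3) ∧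
        ∀ E : Env m n, IsFar ρ ε E → ∃ B : Finset (Fin m × ZMod n),
          (∀ p ∈ B, Rejects ρ (Q p) E) ∧ ε / 2 * m * n ≤ B.card) :
    Testable ρ := by
  classical
  refine ⟨5 * C, by linarith, fun m n _ ε hε hε1 => ?_⟩
  obtain ⟨Q, hQ, hfar⟩ := h m n ε hε hε1
  rcases isEmpty_or_nonempty (Fin m) with hm | hm
  · refine ⟨PMF.pure (canonicalStrategy ρ ∅), ?_, ?_, ?_⟩
    · intro S hS
      rw [PMF.support_pure, Set.mem_singleton_iff] at hS
      subst hS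
      simp only [canonicalStrategy, Finset.card_empty, CharP.cast_eq_zero]
      positivity
    · intro E hE
      rw [PMF.pure_map, PMF.pure_apply, if_pos (run_canonicalStrategy_of_evolves _ hE).symm]
    · intro E hE
      have := hE E (fun t => hm.elim t)
      simp only [Finset.univ_eq_empty, Finset.filter_empty, Finset.card_empty] at this
      have hm0 : m = 0 := by
        by_contra h0
        exact hm.elim ⟨0, Nat.pos_of_ne_zero h0⟩
      simp [hm0] at this
  -- With success probability `ε / 2` per trial, `4 / ε` trials give an expected number of successes
  -- of at least `2`.
  · set r := ⌈4 / ε⌉₊ with hr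
    have hr1 : 4 / ε ≤ r := Nat.le_ceil _
    have hr2 : (r : ℝ) ≤ 5 / ε := by
      have h1 : (r : ℝ) < 4 / ε + 1 := Nat.ceil_lt_add_one (by positivity)
      have h2 : 1 ≤ 1 / ε := by rw [le_div_iff₀ hε]; linarith
      have h3 : (5 : ℝ) / ε = 4 / ε + 1 / ε := by ring
      linarith
    let S : (Fin r → Fin m × ZMod n) → Strategy m n := fun s =>
      canonicalStrategy ρ (Finset.univ.biUnion fun j => Q (s j))
    refine ⟨(PMF.uniformOfFintype (Fin r → Fin m × ZMod n)).map S, ?_, ?_, ?_⟩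
    · intro S' hS'
      rw [PMF.support_map] at hS'
      obtain ⟨s, -, rfl⟩ := hS'
      have h1 : ((Finset.univ.biUnion fun j => Q (s j)).card : ℝ) ≤ ∑ j, ((Q (s j)).card : ℝ) := by
        exact_mod_cast Finset.card_biUnion_le
      have h2 : ∑ j, ((Q (s j)).card : ℝ) ≤ r * (C / ε ^ 3) := by
        refine (Finset.sum_le_sum fun j _ => hQ (s j)).trans ?_
        simp
      calc _ ≤ (r : ℝ) * (C / ε ^ 3) := h1.trans h2
        _ ≤ 5 / ε * (C / ε ^ 3) := by gcongr
        _ = 5 * C / ε ^ 4 := by field_simp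
    · intro E hE
      rw [PMF.map_comp]
      exact map_const_apply _ _ _ fun s => run_canonicalStrategy_of_evolves _ hE
    · intro E hE
      obtain ⟨B, hB, hBcard⟩ := hfar E hE
      rw [PMF.map_comp]
      refine two_thirds_le_map_uniform B (ε / 2) ?_ r ?_ _ ?_
      · rw [Fintype.card_prod, Fintype.card_fin, ZMod.card]
        push_cast; linarith
      · rw [div_le_iff₀ hε] at hr1; linarith
      · rintro s ⟨j, hj⟩
        exact run_canonicalStrategy_of_rejects ((hB _ hj).mono
          (Finset.subset_biUnion_of_mem (fun j => Q (s j)) (Finset.mem_univ j)))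

/-- Query sets for "flip if homogeneous" serve for "flip unless homogeneous" as well. -/
theorem Rejects.of_twist {m n : ℕ} {Q : Finset (Fin m × ZMod n)} {E : Env m n}
    (h : Rejects fih Q (twist E)) : Rejects fuh Q E := by
  intro E' hE'
  obtain ⟨p, hp, hne⟩ := h _ hE'.twist_fuh
  exact ⟨p, hp, fun h' => hne (by simp only [twist, h'])⟩

theorem IsFar.twist {m n : ℕ} [NeZero n] {ε : ℝ} {E : Env m n} (h : IsFar fuh ε E) :
    IsFar fih ε (twist E) := by
  intro E' hE'
  have := h _ hE'.twist_fih
  rwa [Finset.filter_congr (q := fun p => EvolutionTesting.twist E p.1 p.2 ≠ E' p.1 p.2)] at this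
  intro p _
  simp only [EvolutionTesting.twist]
  generalize E p.1 p.2 = a
  generalize E' p.1 p.2 = b
  generalize parity p.1.val = c
  revert a b c; decide

/-! ### Predicting an evolution on the line from a sparse grid

Below, `τ` is a configuration whose inhomogeneous sites come in long intervals, `G` is a grid and
`NF` the set of sites that only have homogeneous grid points around them. -/

section Line
variable {τ η : ℤ → Bool} {t₁ δ : ℕ} {G NF : ℤ → Prop} {K : ℤ}

/-- An inhomogeneous `z` lies in an interval of radius `t₁ ≥ δ`. Moving from `z` towards or past its
centre by less than `δ` meets a grid point still in the interval, at distance at most `(δ + 1) + (δ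
- 1)` from `k`. -/
theorem hom_of_grid_hom (hW : ∀ y, ¬ Hom τ y → ∃ c, |c - y| ≤ t₁ ∧ ∀ z, |z - c| ≤ t₁ → ¬ Hom τ z)
    (hG : ∀ y : ℤ, ∃ g, y ≤ g ∧ g < y + δ ∧ G g)
    (hδ : δ ≤ t₁) {k : ℤ} (h : ∀ g, |g - k| ≤ 2 * δ → G g → Hom τ g) {z : ℤ}
    (hz : |z - k| ≤ δ + 1) : Hom τ z := by
  by_contra hh
  obtain ⟨c, hc, hcz⟩ := hW z hh
  rw [abs_le] at hc hz
  rcases le_total z c with h1 | h1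
  · obtain ⟨g, hg1, hg2, hg⟩ := hG z
    exact hcz g (by rw [abs_le]; omega) (h g (by rw [abs_le]; omega) hg)
  · obtain ⟨g, hg1, hg2, hg⟩ := hG (z - δ + 1)
    exact hcz g (by rw [abs_le]; omega) (h g (by rw [abs_le]; omega) hg)

/-- At the left end of a block of `NF` there is an inhomogeneous grid point at distance `2δ`. -/
theorem grid_of_junction
    (hNF : ∀ k, |k| ≤ K → (NF k ↔ ∀ g, |g - k| ≤ 2 * δ → G g → Hom τ g)) {k : ℤ}
    (hk : |k| ≤ K) (hk1 : |k + 1| ≤ K) (h : ¬ NF k) (h1 : NF (k + 1)) :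
    G (k - 2 * δ) ∧ ¬ Hom τ (k - 2 * δ) := by
  rw [hNF k hk] at h
  rw [hNF _ hk1] at h1
  push Not at h
  obtain ⟨g, hg, hG, hh⟩ := h
  have h2 : ¬ |g - (k + 1)| ≤ 2 * δ := fun h' => hh (h1 g h' hG)
  have : g = k - 2 * δ := by rw [abs_le] at *; omega
  rw [← this]
  exact ⟨hG, hh⟩

/-- Blocks of `NF` are far from each other. -/
theorem not_NF_of_junction
    (hW : ∀ y, ¬ Hom τ y → ∃ c, |c - y| ≤ t₁ ∧ ∀ z, |z - c| ≤ t₁ → ¬ Hom τ z)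
    (hG : ∀ y : ℤ, ∃ g, y ≤ g ∧ g < y + δ ∧ G g) (hδ : δ ≤ t₁)
    (hNF : ∀ k, |k| ≤ K → (NF k ↔ ∀ g, |g - k| ≤ 2 * δ → G g → Hom τ g)) {k : ℤ}
    (hk : |k| ≤ K) (hk1 : |k + 1| ≤ K) (h : ¬ NF k) (h1 : NF (k + 1)) {j : ℤ} (hj0 : 0 ≤ j)
    (hj : j ≤ 2 * t₁) (hkj : |k - j| ≤ K) : ¬ NF (k - j) := by
  obtain ⟨hg, hh⟩ := grid_of_junction hNF hk hk1 h h1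
  rw [hNF _ hk1] at h1
  have h2 : ∀ z, |z - (k + 1)| ≤ δ + 1 → Hom τ z := fun z hz => hom_of_grid_hom hW hG hδ h1 hz
  rw [hNF _ hkj]
  intro h3
  by_cases hc : j ≤ 2 * δ
  · exact hh (h3 _ (by rw [abs_le]; omega) hg)
  obtain ⟨c, hc1, hc2⟩ := hW _ hh
  rw [abs_le] at hc1
  -- The interval around `k - 2δ` must stop before the homogeneous zone near `k`, so it extends to
  -- the left for about its whole length.
  have h4 : c + t₁ < k - δ := by
    by_contra h5
    exact hc2 (k - δ) (by rw [abs_le]; omega) (h2 _ (by rw [abs_le]; omega))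
  exact hc2 (k - j) (by rw [abs_le]; omega)
    (hom_of_grid_hom hW hG hδ h3 (by rw [sub_self, abs_zero]; omega))

/-- Before the end of its block is felt, a site alternates. -/
theorem iterate_eq_of_early {t s d : ℕ} (hhom : ∀ k : ℤ, |k| < d → Hom τ k)
    (hη : ∀ k : ℤ, |k| < d → η k = τ k) (hd : 0 < d) (hs : s ≤ d) (ht : t < d)
    (hpar : parity t = parity s) : step^[s] τ 0 = step^[t] η 0 := by
  have hc : ∀ k : ℤ, |k| < d → η k = τ 0 := fun k hk => by
    rw [hη k hk]
    exact eq_of_hom fun j hj => hhom j (by rw [sub_zero, sub_zero] at hj; exact hj.trans hk)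
  rw [iterate_of_hom (fun j hj => hhom j (by rw [sub_zero] at hj; omega)),
    iterate_of_hom (σ := η), hc 0 (by simpa using hd), hpar]
  intro j hj
  rw [sub_zero, abs_lt] at hj
  constructor <;> rw [hc _ (by rw [abs_lt]; omega), hc _ (by rw [abs_lt]; omega)]

/-- After the left end of the block is felt, a site has its final value. -/
theorem iterate_eq_of_late {w s t d : ℕ}
    (hhom : ∀ k : ℤ, -d - δ ≤ k → k ≤ d + 2 * δ + 1 → Hom τ k)
    (hwall : ¬ Hom τ (-d - 2 * δ))
    (hη : ∀ k : ℤ, -d < k → k ≤ d → η k = τ k)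
    (hη1 : η (-d) = step^[w] τ (-d)) (hη2 : η (-d - 1) = step^[w] τ (-d - 1))
    (hδ : 1 ≤ δ) (hw : 2 * δ ≤ w) (hs : d + 2 * δ ≤ s) (ht : d ≤ t) (hd : 4 * δ < d) :
    step^[s] τ 0 = step^[t] η 0 := by
  classical
  -- `D` is the true distance to the inhomogeneous region on the left; the grid only shows `d + δ <
  -- D ≤ d + 2δ`.
  have hex : ∃ D : ℕ, ¬ Hom τ (-D) := ⟨d + 2 * δ, by push_cast; rwa [neg_add, ← sub_eq_add_neg]⟩
  obtain ⟨D, hD, hDmin⟩ : ∃ D : ℕ, ¬ Hom τ (-D) ∧ ∀ j : ℕ, j < D → Hom τ (-j) :=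
    ⟨Nat.find hex, Nat.find_spec hex, fun j hj => not_not.1 (Nat.find_min hex hj)⟩
  have hDle : D ≤ d + 2 * δ := by
    by_contra h
    have := hDmin (d + 2 * δ) (by omega)
    push_cast at this
    rw [neg_add, ← sub_eq_add_neg] at this
    exact hwall this
  have hDge : d + δ < D := by
    by_contra h
    exact hD (hhom _ (by omega) (by omega))
  have hDhom : ∀ j : ℤ, -D < j → j ≤ d + 2 * δ + 1 → Hom τ j := by
    intro j h1 h2
    by_cases h3 : -d - δ ≤ j
    · exact hhom j h3 h2
    · have := hDmin (-j).toNat (by omega)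
      rwa [Int.toNat_of_nonneg (by omega), neg_neg] at this
  have hconst : ∀ j : ℤ, -D ≤ j → j ≤ d + 2 * δ + 1 → τ j = τ 0 := by
    have := const_of_hom (σ := τ) (a := -D + 1) (b := d + 2 * δ + 1)
      (fun j h1 h2 => hDhom j (by omega) h2)
    intro j h1 h2
    rw [this j (by omega) (by omega) (by omega), this 0 (by omega) (by omega) (by omega)]
  have e0 := (iterate_of_dist (σ := τ) (t := s) (d := D) (k := 0) (a := -D)
    (fun j hj => by rw [abs_lt] at hj; exact hDhom j (by omega) (by omega))
    (by simp) hD (by omega)).1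
  have e1 := (iterate_of_dist (σ := τ) (t := w) (d := D - d) (k := -d) (a := -D)
    (fun j hj => by rw [abs_lt] at hj; exact hDhom j (by omega) (by omega))
    (by rw [abs_of_nonpos] <;> omega) hD (by omega)).1
  have e2 := (iterate_of_dist (σ := τ) (t := w) (d := D - d - 1) (k := -d - 1) (a := -D)
    (fun j hj => by rw [abs_lt] at hj; exact hDhom j (by omega) (by omega))
    (by rw [abs_of_nonpos] <;> omega) hD (by omega)).1
  rw [hconst _ (by omega) (by omega)] at e1 e2
  have p1 : parity (D - d) = !parity (D - d - 1) := by
    rw [← parity_succ]; congr 1; omega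
  have p2 : parity D = xor (parity (D - d)) (parity d) := parity_sub_xor (by omega)
  have p3 : parity d = !parity (d - 1) := by rw [← parity_succ]; congr 1; omega
  have hηc : ∀ k : ℤ, -d < k → k ≤ d → η k = τ 0 := fun k h1 h2 => by
    rw [hη k h1 h2, hconst k (by omega) (by omega)]
  rw [e1] at hη1
  rw [e2] at hη2
  rw [e0]
  -- The frozen bits copied at `-d` and `-d - 1` reveal the parity of `D - d`. If it is even, the
  -- first inhomogeneous site of `η` is `-d`; if odd, it is `-d + 1`. In both cases the number of
  -- flips at the origin has the parity of `D`.
  cases hp : parity (D - d)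
  · rw [hp, Bool.xor_false] at hη1
    have hη3 : η (-d - 1) ≠ η (-d) := by
      rw [hη1, hη2]
      rw [hp] at p1
      simp [show parity (D - d - 1) = true by simpa using p1.symm]
    have e3 := (iterate_of_dist (σ := η) (t := t) (d := d) (k := 0) (a := -d) (fun j hj => by
      rw [abs_lt] at hj
      have : ∀ k : ℤ, -d ≤ k → k ≤ d → η k = τ 0 := fun k h1 h2 => by
        rcases h1.eq_or_lt with h | h
        · rw [← h, hη1]
        · exact hηc k h h2
      constructor <;> rw [this _ (by omega) (by omega), this _ (by omega) (by omega)])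
      (by simp) (fun h => hη3 h.1) ht).1
    rw [e3, hηc 0 (by omega) (by omega), p2, hp, Bool.false_xor]
  · rw [hp, Bool.xor_true] at hη1
    have e3 := (iterate_of_dist (σ := η) (t := t) (d := d - 1) (k := 0) (a := -d + 1) (fun j hj => by
      rw [abs_lt] at hj
      constructor <;> rw [hηc _ (by omega) (by omega), hηc _ (by omega) (by omega)])
      (by rw [abs_of_nonpos] <;> omega) (fun h => by
        have := h.1
        rw [add_sub_cancel_right, hη1, hηc _ (by omega) (by omega)] at this
        simp at this) (by omega)).1
    rw [e3, hηc 0 (by omega) (by omega), p2, hp, p3]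
    simp

/-- The origin is within `4δ + 1` of the boundary of `NF`. -/
def NearBoundary (NF : ℤ → Prop) (δ : ℕ) : Prop := ∃ k : ℤ, |k| ≤ 4 * δ + 1 ∧ ¬ (NF k ↔ NF 0)

/-- The origin is, up to `δ`, in the middle of a block `(-l, r)` of `NF` of radius at most `M`. -/
def NearMiddle (NF : ℤ → Prop) (δ M : ℕ) : Prop :=
  ∃ l r : ℕ, 1 ≤ l ∧ 1 ≤ r ∧ l ≤ M ∧ (∀ k : ℤ, -l < k → k < r → NF k) ∧ ¬ NF (-l) ∧ ¬ NF r ∧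
    l ≤ r + δ ∧ r ≤ l + δ

/-- The time `t` is close to the one at which the origin starts to feel the end of its block. -/
def NearFront (NF : ℤ → Prop) (δ t₁ t : ℕ) : Prop :=
  ∃ d : ℕ, (∀ k : ℤ, |k| < d → NF k) ∧ (¬ NF d ∨ ¬ NF (-d)) ∧ d ≤ t ∧ t < d + t₁ + 2 * δ

/-- Here `τ` is the true state at time `t₁`, while `η` is started at time `0`. Outside the blocks
both are frozen at the compared times. Inside a block with closer end at distance `d`, either `t <
d` and both still alternate, in phase because `t₁` is even, or `d + t₁ + 2δ ≤ t` and both are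
frozen. Excluding `NearMiddle` puts the other end more than `δ` further away, so the error in
locating ends cannot change which one is felt first. -/
theorem iterate_eq_of_not_near {w t : ℕ}
    (hW : ∀ y, ¬ Hom τ y → ∃ c, |c - y| ≤ t₁ ∧ ∀ z, |z - c| ≤ t₁ → ¬ Hom τ z)
    (hG : ∀ y : ℤ, ∃ g, y ≤ g ∧ g < y + δ ∧ G g) (hδ1 : 1 ≤ δ) (hδ : δ ≤ t₁)
    (hNF : ∀ k, |k| ≤ K → (NF k ↔ ∀ g, |g - k| ≤ 2 * δ → G g → Hom τ g))
    (hη : ∀ k, |k| ≤ K → NF k → ∃ g, |g - k| ≤ δ ∧ η k = τ g)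
    (hηJ : ∀ s : ℤ, s = 1 ∨ s = -1 → ∀ k, |k| ≤ K → |k + s| ≤ K → ¬ NF k → NF (k + s) →
      η k = step^[w] τ k ∧ η (k - s) = step^[w] τ (k - s))
    (hη0 : (∀ k, |k| ≤ 1 → ¬ NF k) → ∀ k, |k| ≤ 1 → η k = step^[w] τ k)
    (hw : 2 * δ ≤ w) (ht1 : t₁ ≤ t) (htw : t ≤ t₁ + w) (hK : t + 4 * δ + 1 ≤ K)
    (hpar : parity t₁ = false)
    (hB : ¬ NearBoundary NF δ) (hM : ¬ NearMiddle NF δ t) (hF : ¬ NearFront NF δ t₁ t) :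
    step^[t - t₁] τ 0 = step^[t] η 0 := by
  classical
  have hhom : ∀ k, |k| ≤ K → NF k → ∀ z, |z - k| ≤ δ + 1 → Hom τ z := fun k hk h z hz =>
    hom_of_grid_hom hW hG hδ ((hNF k hk).1 h) hz
  have hητ : ∀ k, |k| ≤ K → NF k → η k = τ k := fun k hk h => by
    obtain ⟨g, hg, e⟩ := hη k hk h
    rw [e]
    exact eq_of_hom fun j hj => hhom k hk h j (by omega)
  simp only [NearBoundary, not_exists, not_and, not_not] at hB
  by_cases h0 : NF 0
  swap
  · have ht2 : t₁ + 2 * δ ≤ t := by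
      by_contra h
      exact hF ⟨0, fun k hk => absurd hk (by simp), Or.inl (by simpa using h0), by omega,
        by omega⟩
    have h1 : ∀ k : ℤ, |k| ≤ 1 → ¬ NF k := fun k hk h' => h0 ((hB k (by omega)).1 h')
    have hη' := hη0 h1
    rw [hNF 0 (by simp; omega)] at h0
    push Not at h0
    obtain ⟨g, hg, -, hgh⟩ := h0
    have hfin : ∀ s : ℕ, 2 * δ ≤ s → ¬ Hom (step^[s] τ) 0 := by
      intro s hs h
      rw [hom_iterate] at h
      exact hgh (h g (by omega))
    -- The origin is already frozen at step `t - t₁`, so its value is the one at step `w`, which `η`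
    -- copies.
    obtain ⟨s, hs⟩ := Nat.exists_eq_add_of_le (show t - t₁ ≤ w by omega)
    have h2 := (iterate_of_not_hom (hfin (t - t₁) (by omega)) s).1
    rw [← Function.iterate_add_apply, add_comm s, ← hs] at h2
    have h3 : ¬ Hom η 0 := by
      intro h
      apply hfin w hw
      have := h
      simp only [Hom] at this ⊢
      rwa [hη' _ (by simp), hη' _ (by simp), hη' _ (by simp)] at this
    rw [(iterate_of_not_hom h3 t).1, hη' 0 (by simp), h2]
  have hNF4 : ∀ k : ℤ, |k| ≤ 4 * δ + 1 → NF k := fun k hk => (hB k hk).2 h0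
  by_cases hex : ∃ d : ℕ, ¬ NF d ∨ ¬ NF (-d)
  swap
  · push Not at hex
    have hall : ∀ k : ℤ, NF k := fun k => by
      obtain ⟨d, rfl | rfl⟩ := Int.eq_nat_or_neg k
      exacts [(hex d).1, (hex d).2]
    refine iterate_eq_of_early (d := t + 1) (fun k hk => ?_) (fun k hk => ?_) (by omega) (by omega)
      (by omega) ?_
    · exact hhom k (by push_cast at hk; omega) (hall k) k (by simp; omega)
    · exact hητ k (by push_cast at hk; omega) (hall k)
    · rw [parity_sub_xor ht1, hpar, Bool.xor_false]
  obtain ⟨d, hd, hdmin⟩ : ∃ d : ℕ, (¬ NF d ∨ ¬ NF (-d)) ∧ ∀ j : ℕ, j < d → NF j ∧ NF (-j) :=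
    ⟨Nat.find hex, Nat.find_spec hex, fun j hj => by
      have := Nat.find_min hex hj
      push Not at this; exact this⟩
  have hin : ∀ k : ℤ, |k| < d → NF k := fun k hk => by
    obtain ⟨j, rfl | rfl⟩ := Int.eq_nat_or_neg k
    · exact (hdmin j (by simpa using hk)).1
    · exact (hdmin j (by simpa using hk)).2
  have hd4 : 4 * δ + 1 < d := by
    by_contra h
    rcases hd with hd | hd
    · exact hd (hNF4 _ (by rw [abs_le]; omega))
    · exact hd (hNF4 _ (by rw [abs_le]; omega))
  rcases lt_or_ge t d with htd | htd
  · refine iterate_eq_of_early (d := t + 1) (fun k hk => ?_) (fun k hk => ?_) (by omega) (by omega)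
      (by omega) ?_
    · exact hhom k (by push_cast at hk; omega) (hin k (by push_cast at hk; omega)) k (by simp; omega)
    · exact hητ k (by push_cast at hk; omega) (hin k (by push_cast at hk; omega))
    · rw [parity_sub_xor ht1, hpar, Bool.xor_false]
  have hlate : d + t₁ + 2 * δ ≤ t := by
    by_contra h
    exact hF ⟨d, hin, hd, htd, by omega⟩
  by_cases hneg : NF (-d)
  · -- the right end is the closer one
    have hpos : ¬ NF d := by tauto
    -- A first failure within `δ` beyond `-d` would make the origin `NearMiddle`.
    have hfar : ∀ j : ℕ, j ≤ δ → NF (-(d + j : ℕ)) := by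
      intro j
      induction j using Nat.strong_induction_on with
      | _ j ih =>
        intro hj
        by_contra hc
        refine hM ⟨d + j, d, by omega, by omega, by omega, fun k h1 h2 => ?_, by exact_mod_cast hc,
          hpos, by omega, by omega⟩
        by_cases h3 : -d < k
        · exact hin k (by rw [abs_lt]; omega)
        · have := ih (-k - d).toNat (by omega) (by omega)
          push_cast at this
          rwa [Int.toNat_of_nonneg (by omega), show -((d:ℤ) + (-k - d)) = k by ring] at this
    have hrun : ∀ k : ℤ, -d - δ ≤ k → k < d → NF k := by
      intro k h1 h2
      by_cases h3 : -d < k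
      · exact hin k (by rw [abs_lt]; omega)
      · have := hfar (-k - d).toNat (by omega)
        push_cast at this
        rwa [Int.toNat_of_nonneg (by omega), show -((d:ℤ) + (-k - d)) = k by ring] at this
    obtain ⟨hη1, hη2⟩ := hηJ (-1) (Or.inr rfl) d (by rw [abs_le]; omega) (by rw [abs_le]; omega) hpos
      (hrun _ (by omega) (by omega))
    have hwall : ¬ Hom τ (d + 2 * δ) := by
      have h1 := hpos
      rw [hNF _ (by rw [abs_le]; omega)] at h1
      push Not at h1
      obtain ⟨g, hg, hgG, hgh⟩ := h1
      have h2 := hrun (d - 1) (by omega) (by omega)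
      rw [hNF _ (by rw [abs_le]; omega)] at h2
      have h3 : ¬ |g - (d - 1)| ≤ 2 * δ := fun h' => hgh (h2 g h' hgG)
      have : g = d + 2 * δ := by rw [abs_le] at *; omega
      rwa [← this]
    -- Reflection reduces the right end to the left end.
    have key := iterate_eq_of_late (τ := fun j => τ (-j)) (η := fun j => η (-j)) (δ := δ) (w := w)
      (s := t - t₁) (t := t) (d := d) ?_ ?_ ?_ ?_ ?_ hδ1 hw (by omega) htd (by omega)
    · simpa only [iterate_neg, neg_zero] using key
    · intro k h1 h2
      rw [hom_neg]
      by_cases h3 : k ≤ d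
      · by_cases h4 : -d < k
        · exact hhom (-k) (by rw [abs_le]; omega) (hrun _ (by omega) (by omega)) _ (by simp; omega)
        · exact hhom (d - 1) (by rw [abs_le]; omega) (hrun _ (by omega) (by omega)) _
            (by rw [abs_le]; omega)
      · exact hhom (-d - δ) (by rw [abs_le]; omega) (hrun _ (by omega) (by omega)) _
          (by rw [abs_le]; omega)
    · rw [hom_neg, show -(-(d:ℤ) - 2 * δ) = d + 2 * δ by ring]; exact hwall
    · intro k h1 h2
      exact hητ _ (by rw [abs_le]; omega) (hrun _ (by omega) (by omega))
    · simp only [iterate_neg, neg_neg]; exact hη1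
    · simp only [iterate_neg, neg_sub, sub_neg_eq_add] at hη2 ⊢
      rwa [add_comm] at hη2
  · -- the left end is the closer one
    have hfar : ∀ j : ℕ, j ≤ δ → NF (d + j : ℕ) := by
      intro j
      induction j using Nat.strong_induction_on with
      | _ j ih =>
        intro hj
        by_contra hc
        refine hM ⟨d, d + j, by omega, by omega, by omega, fun k h1 h2 => ?_, hneg,
          by exact_mod_cast hc, by omega, by omega⟩
        by_cases h3 : k < d
        · exact hin k (by rw [abs_lt]; omega)
        · have := ih (k - d).toNat (by omega) (by omega)
          push_cast at this
          rwa [Int.toNat_of_nonneg (by omega), show (d:ℤ) + (k - d) = k by ring] at this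
    have hrun : ∀ k : ℤ, -d < k → k ≤ d + δ → NF k := by
      intro k h1 h2
      by_cases h3 : k < d
      · exact hin k (by rw [abs_lt]; omega)
      · have := hfar (k - d).toNat (by omega)
        push_cast at this
        rwa [Int.toNat_of_nonneg (by omega), show (d:ℤ) + (k - d) = k by ring] at this
    obtain ⟨hη1, hη2⟩ := hηJ 1 (Or.inl rfl) (-d) (by rw [abs_le]; omega) (by rw [abs_le]; omega)
      hneg (hrun _ (by omega) (by omega))
    have hwall := (grid_of_junction hNF (k := -d) (by rw [abs_le]; omega) (by rw [abs_le]; omega)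
      hneg (hrun _ (by omega) (by omega))).2
    refine iterate_eq_of_late (d := d) (fun k h1 h2 => ?_) hwall (fun k h1 h2 => ?_) hη1 hη2 hδ1 hw
      (by omega) htd (by omega)
    · by_cases h3 : -d < k
      · by_cases h4 : k ≤ d
        · exact hhom k (by rw [abs_le]; omega) (hrun _ (by omega) (by omega)) _ (by simp; omega)
        · exact hhom (d + δ) (by rw [abs_le]; omega) (hrun _ (by omega) (by omega)) _
            (by rw [abs_le]; omega)
      · exact hhom (-d + 1) (by rw [abs_le]; omega) (hrun _ (by omega) (by omega)) _
          (by rw [abs_le]; omega)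
    · exact hητ _ (by rw [abs_le]; omega) (hrun _ (by omega) (by omega))

end Line

/-- The reflected form of `not_NF_of_junction`, for either end of a block. -/
theorem not_NF_of_junction_sign {τ : ℤ → Bool} {t₁ δ : ℕ} {G NF : ℤ → Prop} {K : ℤ}
    (hW : ∀ y, ¬ Hom τ y → ∃ c, |c - y| ≤ t₁ ∧ ∀ z, |z - c| ≤ t₁ → ¬ Hom τ z)
    (hG : ∀ y : ℤ, ∃ g, y ≤ g ∧ g < y + δ ∧ G g) (hδ : δ ≤ t₁)
    (hNF : ∀ k, |k| ≤ K → (NF k ↔ ∀ g, |g - k| ≤ 2 * δ → G g → Hom τ g)) {s k : ℤ}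
    (hs : s = 1 ∨ s = -1) (hk : |k| ≤ K) (hk1 : |k + s| ≤ K) (h : ¬ NF k) (h1 : NF (k + s)) {j : ℤ}
    (hj0 : 0 ≤ j) (hj : j ≤ 2 * t₁) (hkj : |k - s * j| ≤ K) : ¬ NF (k - s * j) := by
  rcases hs with rfl | rfl
  · rw [one_mul] at *
    exact not_NF_of_junction hW hG hδ hNF hk hk1 h h1 hj0 hj hkj
  · have := not_NF_of_junction (τ := fun i => τ (-i)) (G := fun i => G (-i)) (NF := fun i => NF (-i))
      (t₁ := t₁) (δ := δ) (K := K) (k := -k) (j := j) ?_ ?_ hδ ?_ (by rwa [abs_neg])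
      (by rw [abs_le] at *; omega) (by rwa [neg_neg])
      (by rwa [show -(-k + 1) = k + -1 by ring]) hj0 hj (by rw [abs_le] at *; omega)
    · rwa [show -(-k - j) = k - -1 * j by ring] at this
    · intro y hy
      rw [hom_neg] at hy
      obtain ⟨c, hc, hcz⟩ := hW _ hy
      refine ⟨-c, by rw [abs_le] at *; omega, fun z hz => ?_⟩
      rw [hom_neg]
      exact hcz _ (by rw [abs_le] at *; omega)
    · intro y
      obtain ⟨g, h1, h2, hg⟩ := hG (-y - δ + 1)
      exact ⟨-g, by omega, by omega, by rwa [neg_neg]⟩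
    · intro i hi
      rw [hNF (-i) (by rwa [abs_neg])]
      constructor
      · intro h g hg hGg
        rw [hom_neg]
        exact h _ (by rw [abs_le] at *; omega) hGg
      · intro h g hg hGg
        have := h (-g) (by rw [abs_le] at *; omega) (by rwa [neg_neg])
        rwa [hom_neg, neg_neg] at this

/-! ### The grid on the cycle -/

section Grid
variable {n : ℕ}

/-- Grid locations: the multiples of `δ`. -/
def IsGrid (δ : ℕ) (z : ZMod n) : Prop := δ ∣ z.val

theorem val_add_natCast_of_lt [NeZero n] {x : ZMod n} {j : ℕ} (h : x.val + j < n) :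
    (x + (j : ZMod n)).val = x.val + j := by
  have : x + (j : ZMod n) = ((x.val + j : ℕ) : ZMod n) := by simp
  rw [this, ZMod.val_natCast_of_lt h]

/-- If the next multiple of `δ` is not below `n`, the location `0` comes first; the gap at the seam
is at most `δ`. -/
theorem exists_isGrid [NeZero n] {δ : ℕ} (hδ : 1 ≤ δ) (x : ZMod n) :
    ∃ j : ℕ, j < δ ∧ IsGrid δ (x + (j : ZMod n)) := by
  have hr := Nat.mod_lt x.val hδ
  have hdm := Nat.div_add_mod x.val δ
  have hx := x.val_lt
  by_cases h0 : x.val % δ = 0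
  · exact ⟨0, hδ, by simpa [IsGrid] using Nat.dvd_of_mod_eq_zero h0⟩
  by_cases h1 : x.val + (δ - x.val % δ) < n
  · refine ⟨δ - x.val % δ, by omega, ?_⟩
    rw [IsGrid, val_add_natCast_of_lt h1]
    exact ⟨x.val / δ + 1, by rw [mul_add, mul_one]; omega⟩
  · refine ⟨n - x.val, by omega, ?_⟩
    have : x + ((n - x.val : ℕ) : ZMod n) = 0 := by
      rw [Nat.cast_sub hx.le]; simp
    rw [this]; simp [IsGrid]

/-- The closest grid location on the left. -/
def floorGrid (δ : ℕ) (x : ZMod n) : ZMod n := x - ((x.val % δ : ℕ) : ZMod n)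

theorem val_floorGrid [NeZero n] (δ : ℕ) (x : ZMod n) :
    (floorGrid δ x).val = x.val - x.val % δ := by
  have : floorGrid δ x = ((x.val - x.val % δ : ℕ) : ZMod n) := by
    rw [floorGrid, Nat.cast_sub (Nat.mod_le _ _)]; simp
  rw [this, ZMod.val_natCast_of_lt ((Nat.sub_le _ _).trans_lt x.val_lt)]

theorem isGrid_floorGrid [NeZero n] (δ : ℕ) (x : ZMod n) : IsGrid δ (floorGrid δ x) := by
  rw [IsGrid, val_floorGrid]
  exact Nat.dvd_sub_mod _

/-- All grid locations within `2δ` of `x` are homogeneous. -/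
def Clear (δ : ℕ) (σ : Config n) (x : ZMod n) : Prop :=
  ∀ j : ℤ, |j| ≤ 2 * δ → IsGrid δ (x + (j : ZMod n)) → Hom σ (x + j)

open Classical in
/-- The configuration that is read off the grid at clear locations and is `ω` elsewhere. -/
noncomputable def interpolate (δ : ℕ) (σ ω : Config n) : Config n :=
  fun x => if Clear δ σ x then σ (floorGrid δ x) else ω x

open Classical in
/-- The grid locations within distance `r` of `x`. -/
noncomputable def gridNear [NeZero n] (δ r : ℕ) (x : ZMod n) : Finset (ZMod n) :=
  Finset.univ.filter fun z => IsGrid δ z ∧ ∃ j : ℤ, |j| ≤ r ∧ z = x + j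

/-- The grid locations close to `x` are few. -/
theorem card_gridNear_le [NeZero n] {δ : ℕ} (hδ : 1 ≤ δ) (r : ℕ) (x : ZMod n) :
    (gridNear δ r x).card ≤ 2 * (r / δ + 1) + 2 := by
  classical
  set S : ℤ := ((r / δ + 1 : ℕ) : ℤ) with hS
  -- Rounding the offset `j` up to a multiple `s * δ` stays in the grid cell of `z`, unless it
  -- crosses the seam. Only the last grid location can do so, and it is inserted separately.
  have hsub : gridNear δ r x ⊆ insert ((((n - 1) / δ * δ : ℕ) : ZMod n))
      ((Finset.Icc (-S) S).image fun s : ℤ => floorGrid δ (x + ((s * δ : ℤ) : ZMod n))) := by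
    intro z hz
    simp only [gridNear, Finset.mem_filter, Finset.mem_univ, true_and] at hz
    obtain ⟨hzg, j, hj, rfl⟩ := hz
    rw [Finset.mem_insert, Finset.mem_image]
    have hδ' : (0 : ℤ) < δ := by exact_mod_cast hδ
    -- round `j` up to a multiple of `δ`
    set c : ℕ := (-j % δ).toNat with hc
    have hc0 : (c : ℤ) = -j % δ := Int.toNat_of_nonneg (Int.emod_nonneg _ hδ'.ne')
    have hclt : (c : ℤ) < δ := by rw [hc0]; exact Int.emod_lt_of_pos _ hδ'
    have hdm := Int.mul_ediv_add_emod (-j) δ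
    set s : ℤ := -(-j / δ) with hs
    have hjs : j + c = s * δ := by rw [hc0, hs]; linarith [mul_comm (-(-j / (δ:ℤ))) (δ:ℤ)]
    obtain ⟨q, hq⟩ := hzg
    have hzlt := (x + (j : ZMod n)).val_lt
    by_cases hw : (x + (j : ZMod n)).val + c < n
    · right
      refine ⟨s, ?_, ?_⟩
      · rw [abs_le] at hj
        have h1 := Nat.div_add_mod r δ
        have h2 := Nat.mod_lt r hδ
        have h1' : (δ : ℤ) * ((r / δ : ℕ) : ℤ) + ((r % δ : ℕ) : ℤ) = r := by exact_mod_cast h1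
        have h2' : ((r % δ : ℕ) : ℤ) < δ := by exact_mod_cast h2
        have hS' : S = ((r / δ : ℕ) : ℤ) + 1 := by rw [hS]; push_cast; rfl
        rw [Finset.mem_Icc]
        constructor
        · by_contra hcon
          push Not at hcon
          have : s + 1 ≤ -S := hcon
          nlinarith
        · by_contra hcon
          push Not at hcon
          have : S + 1 ≤ s := hcon
          nlinarith
      · have e : x + ((s * δ : ℤ) : ZMod n) = x + (j : ZMod n) + (c : ℕ) := by
          rw [← hjs]; push_cast; ring
        rw [e]
        apply ZMod.val_injective
        rw [val_floorGrid, val_add_natCast_of_lt hw, hq, Nat.mul_add_mod,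
          Nat.mod_eq_of_lt (by exact_mod_cast hclt)]
        omega
    · left
      have hqn : (n - 1) / δ = q := by
        have hclt' : c < δ := by exact_mod_cast hclt
        rw [Nat.div_eq_iff (by omega)]
        rw [hq] at hzlt hw
        rw [mul_comm q]
        constructor <;> omega
      rw [hqn, mul_comm, ← hq]
      simp
  calc (gridNear δ r x).card ≤ _ := Finset.card_le_card hsub
    _ ≤ _ := Finset.card_insert_le _ _
    _ ≤ (Finset.Icc (-S) S).card + 1 := Nat.add_le_add_right Finset.card_image_le 1
    _ = 2 * (r / δ + 1) + 2 := by rw [Int.card_Icc]; omega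

end Grid

/-! ### The queries -/

section Queries
variable {m n : ℕ} [NeZero n]

open Classical in
/-- The queries that go with a grid location. -/
noncomputable def gridQueries (t₁ tl : Fin m) (δ : ℕ) (g : ZMod n) : Finset (Fin m × ZMod n) :=
  {(t₁, g - 1), (t₁, g), (t₁, g + 1),
    (tl, g + ((2 * δ : ℤ) : ZMod n)), (tl, g + ((2 * δ - 1 : ℤ) : ZMod n)),
    (tl, g + ((-(2 * δ) : ℤ) : ZMod n)), (tl, g + ((-(2 * δ) + 1 : ℤ) : ZMod n))}

open Classical in
/-- The query set of a time-location pair. -/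
noncomputable def querySet (t₁ tl : Fin m) (δ r : ℕ) (p : Fin m × ZMod n) :
    Finset (Fin m × ZMod n) :=
  {p, (tl, p.2 - 1), (tl, p.2), (tl, p.2 + 1)} ∪ (gridNear δ r p.2).biUnion (gridQueries t₁ tl δ)

theorem card_querySet_le (t₁ tl : Fin m) {δ : ℕ} (hδ : 1 ≤ δ) (r : ℕ) (p : Fin m × ZMod n) :
    (querySet t₁ tl δ r p).card ≤ 4 + (2 * (r / δ + 1) + 2) * 7 := by
  classical
  refine (Finset.card_union_le _ _).trans (Nat.add_le_add Finset.card_le_four ?_)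
  refine (Finset.card_biUnion_le_card_mul _ _ 7 fun g _ => (Finset.card_insert_le _ _).trans (Nat.succ_le_succ Finset.card_le_six)).trans ?_
  exact Nat.mul_le_mul_right _ (card_gridNear_le hδ r p.2)

end Queries

/-! ### What a non-rejecting query set forces -/

section Prediction
variable {m n : ℕ} [NeZero n] {E E' : Env m n} {t₁ tl t : Fin m} {δ r : ℕ} {x : ZMod n} {K : ℤ}

theorem mem_querySet {g : ℤ} (hg : |g| ≤ r) (hG : IsGrid δ (x + (g : ZMod n)))
    {q : Fin m × ZMod n} (hq : q ∈ gridQueries t₁ tl δ (x + (g : ZMod n))) :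
    q ∈ querySet t₁ tl δ r (t, x) := by
  classical
  refine Finset.mem_union_right _ (Finset.mem_biUnion.2 ⟨_, ?_, hq⟩)
  simp only [gridNear, Finset.mem_filter, Finset.mem_univ, true_and]
  exact ⟨hG, g, hg, rfl⟩

/-- On the grid, agreement on the queries determines which locations are homogeneous. -/
theorem hom_iff_of_agree (hag : ∀ q ∈ querySet t₁ tl δ r (t, x), E' q.1 q.2 = E q.1 q.2) {g : ℤ}
    (hg : |g| ≤ r) (hG : IsGrid δ (x + (g : ZMod n))) :
    Hom (fun k : ℤ => E' t₁ (x + k)) g ↔ Hom (E t₁) (x + g) := by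
  rw [hom_lift]
  unfold Hom
  rw [hag _ (mem_querySet (q := (t₁, _)) hg hG (by simp [gridQueries])),
    hag _ (mem_querySet (q := (t₁, _)) hg hG (by simp [gridQueries])),
    hag _ (mem_querySet (q := (t₁, _)) hg hG (by simp [gridQueries]))]

/-- Clearness at `k` involves grid points up to `2δ` away, hence the margin between `K` and `r`. -/
theorem clear_iff_of_agree (hag : ∀ q ∈ querySet t₁ tl δ r (t, x), E' q.1 q.2 = E q.1 q.2)
    (hK : K + 2 * δ ≤ r) (k : ℤ) (hk : |k| ≤ K) : Clear δ (E t₁) (x + (k : ZMod n)) ↔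
      ∀ g : ℤ, |g - k| ≤ 2 * δ → IsGrid δ (x + (g : ZMod n)) →
        Hom (fun k : ℤ => E' t₁ (x + k)) g := by
  constructor
  · intro h g hg hG
    rw [hom_iff_of_agree hag (by rw [abs_le] at *; omega) hG]
    have := h (g - k) hg
    rw [add_assoc, ← Int.cast_add, add_sub_cancel] at this
    exact this hG
  · intro h j hj
    rw [add_assoc, ← Int.cast_add]
    intro hG
    rw [← hom_iff_of_agree hag (by rw [abs_le] at *; omega) hG]
    exact h _ (by simpa using hj) hG

theorem exists_grid_lift (hδ : 1 ≤ δ) (x : ZMod n) (y : ℤ) :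
    ∃ g : ℤ, y ≤ g ∧ g < y + δ ∧ IsGrid δ (x + (g : ZMod n)) := by
  obtain ⟨j, hj, hG⟩ := exists_isGrid hδ (x + (y : ZMod n))
  refine ⟨y + j, by omega, by omega, ?_⟩
  rwa [Int.cast_add, ← add_assoc, Int.cast_natCast]

omit [NeZero n] in
theorem Evolves.exists_center (hE' : Evolves fih E') (t₁ : Fin m) (x : ZMod n) :
    ∀ y, ¬ Hom (fun k : ℤ => E' t₁ (x + k)) y →
      ∃ c, |c - y| ≤ t₁.val ∧ ∀ z, |z - c| ≤ t₁.val → ¬ Hom (fun k : ℤ => E' t₁ (x + k)) z := by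
  have h0 : E' t₁ = step^[t₁.val] (E' ⟨0, by have := t₁.isLt; omega⟩) :=
    hE'.eq_iterate (by simp)
  intro y
  rw [h0, iterate_comp_add]
  exact EvolutionTesting.exists_center

/-- The ends of blocks of clear locations that are seen from a non-rejecting query set are good. -/
theorem not_clear_of_agree (hE' : Evolves fih E')
    (hag : ∀ q ∈ querySet t₁ tl δ r (t, x), E' q.1 q.2 = E q.1 q.2)
    (hδ1 : 1 ≤ δ) (hδ : δ ≤ t₁.val) (hK : K + 2 * δ ≤ r) {s k : ℤ} (hs : s = 1 ∨ s = -1)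
    (hk : |k| + 2 * t₁.val + 1 ≤ K) (h : ¬ Clear δ (E t₁) (x + (k : ZMod n)))
    (h1 : Clear δ (E t₁) (x + ((k + s : ℤ) : ZMod n))) {j : ℤ} (hj0 : 0 ≤ j)
    (hj : j ≤ 2 * t₁.val) : ¬ Clear δ (E t₁) (x + ((k - s * j : ℤ) : ZMod n)) := by
  have hk1 := neg_abs_le k
  have hk2 := le_abs_self k
  refine not_NF_of_junction_sign (NF := fun k : ℤ => Clear δ (E t₁) (x + (k : ZMod n))) (K := K)
    (hE'.exists_center t₁ x) (exists_grid_lift hδ1 x) hδ (clear_iff_of_agree hag hK) hs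
    (by omega) (by rcases hs with rfl | rfl <;> rw [abs_le] <;> omega) h h1 hj0 hj
    (by rcases hs with rfl | rfl <;> rw [abs_le] <;> omega)

/-- A value that the queries do not refute is the one predicted by the interpolation. -/
theorem eq_iterate_interpolate (hE' : Evolves fih E')
    (hag : ∀ q ∈ querySet t₁ tl δ r (t, x), E' q.1 q.2 = E q.1 q.2)
    (hδ1 : 1 ≤ δ) (hδ : δ ≤ t₁.val) (hr : t.val + 7 * δ + 1 ≤ r)
    (htl : tl.val + 1 = m) (hw : t₁.val + 2 * δ ≤ tl.val) (ht1 : t₁.val ≤ t.val)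
    (hpar : parity t₁.val = false)
    (hB : ¬ NearBoundary (fun k : ℤ => Clear δ (E t₁) (x + (k : ZMod n))) δ)
    (hM : ¬ NearMiddle (fun k : ℤ => Clear δ (E t₁) (x + (k : ZMod n))) δ t.val)
    (hF : ¬ NearFront (fun k : ℤ => Clear δ (E t₁) (x + (k : ZMod n))) δ t₁.val t.val) :
    E t x = step^[t.val] (interpolate δ (E t₁) (E tl)) x := by
  classical
  have htlt := t.isLt
  have hEt : E' t x = E t x := hag (t, x) (by simp [querySet])
  have hE't : E' t = step^[t.val - t₁.val] (E' t₁) := hE'.eq_iterate (by omega)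
  have hE'l : E' tl = step^[tl.val - t₁.val] (E' t₁) := hE'.eq_iterate (by omega)
  have hω : ∀ k : ℤ, step^[tl.val - t₁.val] (fun k : ℤ => E' t₁ (x + k)) k = E' tl (x + k) := by
    intro k; rw [hE'l, iterate_lift]
  have hNF := clear_iff_of_agree (K := t.val + 4 * δ + 1) hag (by omega)
  rw [← hEt, hE't, iterate_lift_zero (E' t₁), iterate_lift_zero (interpolate _ _ _)]
  refine iterate_eq_of_not_near (δ := δ) (w := tl.val - t₁.val) (K := t.val + 4 * δ + 1)
    (hE'.exists_center t₁ x) (exists_grid_lift hδ1 x) hδ1 hδ hNF ?_ ?_ ?_ (by omega) ht1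
    (by omega) le_rfl hpar hB hM hF
  · intro k hk hc
    have e : floorGrid δ (x + (k : ZMod n)) =
        x + ((k - ((x + (k : ZMod n)).val % δ : ℕ) : ℤ) : ZMod n) := by
      rw [floorGrid, Int.cast_sub, Int.cast_natCast, add_sub_assoc]
    have hlt := Nat.mod_lt (x + (k : ZMod n)).val hδ1
    have hgrid := isGrid_floorGrid δ (x + (k : ZMod n))
    rw [e] at hgrid
    refine ⟨k - ((x + (k : ZMod n)).val % δ : ℕ), by rw [abs_le]; omega, ?_⟩
    rw [interpolate, if_pos hc, e]
    exact (hag _ (mem_querySet (q := (t₁, _)) (by rw [abs_le] at *; omega) hgrid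
      (by simp [gridQueries]))).symm
  · intro s hs k hk hks hc hcs
    rw [hω, hω]
    have hc' := hc
    have hcs' := hcs
    simp only [Clear, not_forall] at hc
    obtain ⟨j, hj, hG, hh⟩ := hc
    -- The grid point spoiling `k` is out of reach of `k + s`, so it is at distance exactly `2δ` on
    -- the other side. This is why `gridQueries` probes the last row at offsets `±2δ` and one site
    -- closer.
    have hj2 : j = -2 * δ * s := by
      have h2 : ¬ |j - s| ≤ 2 * δ := by
        intro h'
        have := hcs (j - s) h'
        rw [add_assoc, ← Int.cast_add, show k + s + (j - s) = k + j by ring, Int.cast_add,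
          ← add_assoc] at this
        exact hh (this hG)
      rcases hs with rfl | rfl <;> rw [abs_le] at * <;> omega
    rw [add_assoc, ← Int.cast_add] at hG hh
    have hkr : |k + j| ≤ r := by rw [abs_le] at *; omega
    have hq : ∀ i : ℤ, (tl, x + ((k + j : ℤ) : ZMod n) + (i : ZMod n)) ∈
        gridQueries t₁ tl δ (x + ((k + j : ℤ) : ZMod n)) →
        E' tl (x + ((k + j + i : ℤ) : ZMod n)) = E tl (x + ((k + j + i : ℤ) : ZMod n)) := by
      intro i hi
      have := hag _ (mem_querySet hkr hG hi)
      simpa only [Int.cast_add, add_assoc] using this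
    have hnc : ¬ Clear δ (E t₁) (x + ((k - s : ℤ) : ZMod n)) := by
      intro h'
      have := h' (j + s) (by rcases hs with rfl | rfl <;> rw [abs_le] at * <;> omega)
      rw [add_assoc, ← Int.cast_add, show k - s + (j + s) = k + j by ring] at this
      exact hh (this hG)
    rw [interpolate, if_neg hc', interpolate, if_neg hnc]
    rcases hs with rfl | rfl
    · have h1 := hq (2 * δ) (by simp [gridQueries])
      have h2 := hq (2 * δ - 1) (by simp [gridQueries])
      rw [show k + j + 2 * δ = k by rw [hj2]; ring] at h1
      rw [show k + j + (2 * δ - 1) = k - 1 by rw [hj2]; ring] at h2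
      exact ⟨h1.symm, h2.symm⟩
    · have h1 := hq (-(2 * δ)) (by simp [gridQueries])
      have h2 := hq (-(2 * δ) + 1) (by simp [gridQueries])
      rw [show k + j + -(2 * δ) = k by rw [hj2]; ring] at h1
      rw [show k + j + (-(2 * δ) + 1) = k - -1 by rw [hj2]; ring] at h2
      exact ⟨h1.symm, h2.symm⟩
  · intro hc k hk
    rw [hω, interpolate, if_neg (hc k hk)]
    have hk' : k = -1 ∨ k = 0 ∨ k = 1 := by rw [abs_le] at hk; omega
    rcases hk' with rfl | rfl | rfl
    · exact (hag (tl, x + ((-1 : ℤ) : ZMod n)) (by simp [querySet, sub_eq_add_neg])).symm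
    · exact (hag (tl, x + ((0 : ℤ) : ZMod n)) (by simp [querySet])).symm
    · exact (hag (tl, x + ((1 : ℤ) : ZMod n)) (by simp [querySet])).symm

end Prediction

/-! ### Counting the exceptional locations -/

theorem exists_change {P : ℤ → Prop} {a b : ℤ} (hab : a ≤ b) (h : ¬ (P a ↔ P b)) :
    ∃ c, a ≤ c ∧ c < b ∧ ¬ (P c ↔ P (c + 1)) := by
  by_contra hc
  push Not at hc
  apply h
  have : ∀ j : ℕ, a + j ≤ b → (P a ↔ P (a + j)) := by
    intro j
    induction j with
    | zero => simp
    | succ j ih =>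
      intro hj
      push_cast at hj ⊢
      rw [ih (by omega), hc (a + j) (by omega) (by omega), add_assoc]
  have h1 := this (b - a).toNat (by omega)
  rwa [Int.toNat_of_nonneg (by omega), add_sub_cancel] at h1

theorem NearBoundary.exists_end {NF : ℤ → Prop} {δ : ℕ} (h : NearBoundary NF δ) :
    ∃ s : ℤ, (s = 1 ∨ s = -1) ∧ ∃ k : ℤ, |k| ≤ 4 * δ + 1 ∧ ¬ NF k ∧ NF (k + s) := by
  obtain ⟨k, hk, hne⟩ := h
  obtain ⟨c, hc, hne⟩ : ∃ c, (-(4 * δ + 1 : ℤ) ≤ c ∧ c < 4 * δ + 1) ∧ ¬ (NF c ↔ NF (c + 1)) := by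
    rw [abs_le] at hk
    rcases le_total k 0 with h0 | h0
    · obtain ⟨c, h1, h2, h3⟩ := exists_change h0 hne
      exact ⟨c, by omega, h3⟩
    · obtain ⟨c, h1, h2, h3⟩ := exists_change h0 (fun h => hne h.symm)
      exact ⟨c, by omega, h3⟩
  by_cases hN : NF c
  · refine ⟨-1, Or.inr rfl, c + 1, by rw [abs_le]; omega, by tauto, by simpa using hN⟩
  · exact ⟨1, Or.inl rfl, c, by rw [abs_le]; omega, hN, by tauto⟩

/-- The time at which a location starts to feel the end of its block is unique. -/
theorem card_nearFront_le {NF : ℤ → Prop} {δ t₁ m : ℕ} (B : Finset (Fin m))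
    (hB : ∀ t ∈ B, NearFront NF δ t₁ t.val) : B.card ≤ t₁ + 2 * δ := by
  classical
  rcases B.eq_empty_or_nonempty with rfl | ⟨t₀, ht₀⟩
  · simp
  obtain ⟨d, hin, hd, -, -⟩ := hB t₀ ht₀
  have hsub : B.image Fin.val ⊆ Finset.Ico d (d + t₁ + 2 * δ) := by
    intro j hj
    obtain ⟨t, ht, rfl⟩ := Finset.mem_image.1 hj
    obtain ⟨d', hin', hd', h1, h2⟩ := hB t ht
    -- The distance to the closest block end depends on `NF` alone, not on the time.
    have : d = d' := by
      rcases lt_trichotomy d d' with h | h | h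
      · exact absurd hd (by
          rw [not_or, not_not, not_not]
          exact ⟨hin' _ (by simpa using h), hin' _ (by simpa using h)⟩)
      · exact h
      · exact absurd hd' (by
          rw [not_or, not_not, not_not]
          exact ⟨hin _ (by simpa using h), hin _ (by simpa using h)⟩)
    subst this
    exact Finset.mem_Ico.2 ⟨h1, h2⟩
  calc B.card = (B.image Fin.val).card := (Finset.card_image_of_injective _ Fin.val_injective).symm
    _ ≤ _ := Finset.card_le_card hsub
    _ = t₁ + 2 * δ := by rw [Nat.card_Ico]; omega

/-! ### Block ends and block midpoints on the cycle -/

section Cycle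
variable {n : ℕ} [NeZero n]

open Classical in
/-- The ends, in direction `-s`, of the blocks of `P` that are preceded by a gap of length `w`. -/
noncomputable def blockEnds (P : ZMod n → Prop) (s : ℤ) (w : ℕ) : Finset (ZMod n) :=
  Finset.univ.filter fun y => ¬ P y ∧ P (y + (s : ZMod n)) ∧
    ∀ j : ℕ, j < w → ¬ P (y - (s : ZMod n) * (j : ZMod n))

/-- The gaps of length `w` in front of different ends are disjoint: an overlap would put the first
site of one block into the gap of the other. -/
theorem card_blockEnds_mul_le (P : ZMod n → Prop) (s : ℤ) (w : ℕ) :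
    (blockEnds P s w).card * w ≤ n := by
  classical
  have hinj : Set.InjOn (fun q : ZMod n × ℕ => q.1 - (s : ZMod n) * (q.2 : ZMod n))
      (blockEnds P s w ×ˢ Finset.range w : Finset (ZMod n × ℕ)) := by
    have key : ∀ y y' : ZMod n, y ∈ blockEnds P s w → y' ∈ blockEnds P s w → ∀ k k' : ℕ,
        k' < w → k < k' → y - (s : ZMod n) * (k : ZMod n) ≠ y' - (s : ZMod n) * (k' : ZMod n) := by
      intro y y' hy hy' k k' hk' hkk h
      simp only [blockEnds, Finset.mem_filter, Finset.mem_univ, true_and] at hy hy'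
      obtain ⟨i, rfl⟩ := Nat.exists_eq_add_of_lt hkk
      apply hy'.2.2 i (by omega)
      have e : y' - (s : ZMod n) * (i : ZMod n) = y + s := by
        have : y = y' - (s : ZMod n) * ((k + i + 1 : ℕ) : ZMod n) + (s : ZMod n) * (k : ZMod n) := by
          rw [← h]; ring
        rw [this]; push_cast; ring
      rw [e]; exact hy.2.1
    rintro ⟨y, k⟩ hq ⟨y', k'⟩ hq' h
    simp only [Finset.coe_product, Set.mem_prod, Finset.mem_coe, Finset.mem_range] at hq hq'
    simp only at h
    rcases lt_trichotomy k k' with h1 | h1 | h1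
    · exact absurd h (key _ _ hq.1 hq'.1 _ _ hq'.2 h1)
    · subst h1
      rw [sub_left_inj] at h
      rw [h]
    · exact absurd h.symm (key _ _ hq'.1 hq.1 _ _ hq.2 h1)
  have := Finset.card_le_card_of_injOn _ (t := Finset.univ) (fun _ _ => Finset.mem_univ _) hinj
  rwa [Finset.card_product, Finset.card_range, Finset.card_univ, ZMod.card] at this

/-- The midpoints, up to `δ`, of a block that starts after `y`. -/
def IsMiddleAt (P : ZMod n → Prop) (δ : ℕ) (y : ZMod n) (l : ℕ) : Prop :=
  ∃ r : ℕ, 1 ≤ r ∧ (∀ i : ℕ, 0 < i → i < l + r → P (y + (i : ZMod n))) ∧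
    ¬ P (y + ((l + r : ℕ) : ZMod n)) ∧ l ≤ r + δ ∧ r ≤ l + δ

-- The sum `l + r` is the position of the first failure of `P` after `y`, hence fixed; `|l - r| ≤ δ`
-- then leaves at most `δ + 1` values for `l`.
omit [NeZero n] in
theorem exists_middle_range (P : ZMod n → Prop) (δ : ℕ) (y : ZMod n) :
    ∃ S : Finset ℕ, S.card ≤ δ + 1 ∧ ∀ l, IsMiddleAt P δ y l → l ∈ S := by
  by_cases h : ∃ l, IsMiddleAt P δ y l
  · obtain ⟨l₀, r₀, hr₀, hin₀, hout₀, -, -⟩ := h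
    refine ⟨Finset.Icc ((l₀ + r₀ + 1 - δ) / 2) ((l₀ + r₀ + δ) / 2), ?_, ?_⟩
    · rw [Nat.card_Icc]; omega
    · rintro l ⟨r, hr, hin, hout, h1, h2⟩
      have : l + r = l₀ + r₀ := by
        rcases lt_trichotomy (l + r) (l₀ + r₀) with h | h | h
        · exact absurd (hin₀ _ (by omega) h) hout
        · exact h
        · exact absurd (hin _ (by omega) h) hout₀
      rw [Finset.mem_Icc]; omega
  · push Not at h
    exact ⟨∅, by simp, fun l hl => absurd hl (h l)⟩

/-- The locations close to an end or to the middle of a block are few. -/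
theorem exists_exceptional (P : ZMod n → Prop) (δ w : ℕ) :
    ∃ X : Finset (ZMod n), X.card * w ≤ (17 * δ + 7) * n ∧
      (∀ s : ℤ, s = 1 ∨ s = -1 → ∀ y ∈ blockEnds P s w, ∀ k : ℤ, |k| ≤ 4 * δ + 1 →
        y - (k : ZMod n) ∈ X) ∧
      (∀ y ∈ blockEnds P 1 w, ∀ l, IsMiddleAt P δ y l → y + (l : ZMod n) ∈ X) := by
  classical
  choose S hScard hS using exists_middle_range P δ
  let I : Finset ℤ := Finset.Icc (-(4 * δ + 1 : ℤ)) (4 * δ + 1)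
  let X₁ : ℤ → Finset (ZMod n) := fun s =>
    (blockEnds P s w).biUnion fun y => I.image fun k : ℤ => y - (k : ZMod n)
  let X₂ : Finset (ZMod n) :=
    (blockEnds P 1 w).biUnion fun y => (S y).image fun l : ℕ => y + (l : ZMod n)
  have hI : I.card = 8 * δ + 3 := by simp only [I, Int.card_Icc]; omega
  have h1 : ∀ s, (X₁ s).card ≤ (blockEnds P s w).card * (8 * δ + 3) := fun s =>
    Finset.card_biUnion_le_card_mul _ _ _ fun y _ => Finset.card_image_le.trans hI.le
  have h2 : X₂.card ≤ (blockEnds P 1 w).card * (δ + 1) :=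
    Finset.card_biUnion_le_card_mul _ _ _ fun y _ => Finset.card_image_le.trans (hScard y)
  refine ⟨X₁ 1 ∪ X₁ (-1) ∪ X₂, ?_, ?_, ?_⟩
  · have h3 := card_blockEnds_mul_le P 1 w
    have h4 := card_blockEnds_mul_le P (-1) w
    have h5 : (X₁ 1 ∪ X₁ (-1) ∪ X₂).card ≤ (X₁ 1).card + (X₁ (-1)).card + X₂.card :=
      (Finset.card_union_le _ _).trans (Nat.add_le_add_right (Finset.card_union_le _ _) _)
    calc (X₁ 1 ∪ X₁ (-1) ∪ X₂).card * w
        ≤ ((blockEnds P 1 w).card * (8 * δ + 3) + (blockEnds P (-1) w).card * (8 * δ + 3) +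
          (blockEnds P 1 w).card * (δ + 1)) * w :=
          Nat.mul_le_mul_right _ (h5.trans (add_le_add (add_le_add (h1 1) (h1 (-1))) h2))
      _ = (blockEnds P 1 w).card * w * (9 * δ + 4) +
          (blockEnds P (-1) w).card * w * (8 * δ + 3) := by ring
      _ ≤ n * (9 * δ + 4) + n * (8 * δ + 3) :=
          add_le_add (Nat.mul_le_mul_right _ h3) (Nat.mul_le_mul_right _ h4)
      _ = (17 * δ + 7) * n := by ring
  · intro s hs y hy k hk
    have : y - (k : ZMod n) ∈ X₁ s := Finset.mem_biUnion.2
      ⟨y, hy, Finset.mem_image.2 ⟨k, Finset.mem_Icc.2 (abs_le.1 hk), rfl⟩⟩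
    rcases hs with rfl | rfl
    · exact Finset.mem_union_left _ (Finset.mem_union_left _ this)
    · exact Finset.mem_union_left _ (Finset.mem_union_right _ this)
  · intro y hy l hl
    exact Finset.mem_union_right _ (Finset.mem_biUnion.2
      ⟨y, hy, Finset.mem_image.2 ⟨l, hS y l hl, rfl⟩⟩)

end Cycle

/-! ### Counting the disagreements that are not detected -/

section Soundness
variable {m n : ℕ} [NeZero n] {E : Env m n} {t₁ tl : Fin m} {δ r : ℕ}

/-- Up to few exceptions, the query set of a time-location pair with a value other than the
predicted one rejects. -/
theorem card_ne_le (hδ1 : 1 ≤ δ) (hδ : δ ≤ t₁.val) (hr : m + 7 * δ + 2 * t₁.val + 3 ≤ r)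
    (htl : tl.val + 1 = m) (hw : t₁.val + 2 * δ ≤ tl.val) (hpar : parity t₁.val = false)
    (B : Finset (Fin m × ZMod n)) (hB : ∀ p, p ∈ B ↔ Rejects fih (querySet t₁ tl δ r p) E) :
    ((Finset.univ.filter fun p : Fin m × ZMod n =>
      E p.1 p.2 ≠ step^[p.1.val] (interpolate δ (E t₁) (E tl)) p.2).card * (2 * t₁.val) ≤
      (B.card + (2 * t₁.val + 2 * δ) * n) * (2 * t₁.val) + m * ((17 * δ + 7) * n)) := by
  classical
  obtain ⟨X, hX, hX1, hX2⟩ := exists_exceptional (Clear δ (E t₁)) δ (2 * t₁.val)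
  let NF : ZMod n → ℤ → Prop := fun x k => Clear δ (E t₁) (x + (k : ZMod n))
  let T : ZMod n → Finset (Fin m) := fun x =>
    Finset.univ.filter fun t => NearFront (NF x) δ t₁.val t.val
  let A : Finset (Fin m × ZMod n) := Finset.Iio t₁ ×ˢ Finset.univ
  let F : Finset (Fin m × ZMod n) :=
    Finset.univ.biUnion fun x => (T x).image fun t => (t, x)
  let M : Finset (Fin m × ZMod n) := Finset.univ ×ˢ X
  have hsub : (Finset.univ.filter fun p : Fin m × ZMod n =>
      E p.1 p.2 ≠ step^[p.1.val] (interpolate δ (E t₁) (E tl)) p.2) ⊆ B ∪ A ∪ F ∪ M := by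
    rintro ⟨t, x⟩ hp
    simp only [Finset.mem_filter, Finset.mem_univ, true_and] at hp
    by_contra hout
    simp only [Finset.mem_union, not_or] at hout
    obtain ⟨⟨⟨hoB, hoA⟩, hoF⟩, hoM⟩ := hout
    have ht1 : t₁ ≤ t := by simpa [A] using hoA
    have hF : ¬ NearFront (NF x) δ t₁.val t.val := fun h => hoF
      (Finset.mem_biUnion.2 ⟨x, Finset.mem_univ _, Finset.mem_image.2 ⟨t, by simpa [T] using h, rfl⟩⟩)
    have hxX : x ∉ X := by simpa [M] using hoM
    rw [hB, Rejects] at hoB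
    push Not at hoB
    obtain ⟨E', hE', hag⟩ := hoB
    have htlt := t.isLt
    -- As `E` is arbitrary, its blocks need not have long gaps between them; the gap is known only
    -- at ends in the window of a non-rejecting query set, through the witness `E'`.
    have hend : ∀ s k : ℤ, s = 1 ∨ s = -1 → |k| ≤ m + 5 * δ + 1 → ¬ NF x k → NF x (k + s) →
        x + (k : ZMod n) ∈ blockEnds (Clear δ (E t₁)) s (2 * t₁.val) := by
      intro s k hs hk h h1
      simp only [blockEnds, Finset.mem_filter, Finset.mem_univ, true_and]
      refine ⟨h, by simpa only [NF, Int.cast_add, add_assoc] using h1, fun j hj => ?_⟩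
      have := not_clear_of_agree (K := m + 5 * δ + 2 * t₁.val + 2) hE' hag hδ1 hδ (by omega) hs
        (by omega) h h1 (j := j) (by omega) (by omega)
      convert this using 2
      push_cast; ring
    refine hp (eq_iterate_interpolate hE' hag hδ1 hδ (by omega) htl hw ht1 hpar ?_ ?_ hF)
    · intro h
      obtain ⟨s, hs, k, hk, hk1, hk2⟩ := h.exists_end
      have := hX1 s hs _ (hend s k hs (by omega) hk1 hk2) k hk
      rw [add_sub_cancel_right] at this
      exact hxX this
    · rintro ⟨l, r', hl, hr', hlM, hin, hlo, hro, h1, h2⟩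
      have hy := hend 1 (-l) (Or.inl rfl) (by rw [abs_neg, Nat.abs_cast]; omega) hlo
        (hin _ (by omega) (by omega))
      have e : ∀ i : ℕ, x + ((-l : ℤ) : ZMod n) + (i : ZMod n) = x + ((i - l : ℤ) : ZMod n) := by
        intro i; push_cast; ring
      have := hX2 _ hy l ⟨r', hr', fun i hi0 hi => ?_, ?_, h1, h2⟩
      · rw [e, sub_self, Int.cast_zero, add_zero] at this
        exact hxX this
      · rw [e]
        exact hin _ (by omega) (by omega)
      · rw [e, show (((l + r' : ℕ) : ℤ) - l) = r' by push_cast; ring]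
        exact hro
  have hA : A.card = t₁.val * n := by
    simp [A, ZMod.card]
  have hF : F.card ≤ n * (t₁.val + 2 * δ) := by
    have := Finset.card_biUnion_le_card_mul (Finset.univ : Finset (ZMod n))
      (fun x => (T x).image fun t => (t, x)) (t₁.val + 2 * δ) (fun x _ =>
        Finset.card_image_le.trans (card_nearFront_le (NF := NF x) (T x) fun t ht => by
          simpa [T] using ht))
    rwa [Finset.card_univ, ZMod.card] at this
  have hM : M.card = m * X.card := by simp [M]
  have hcard := Finset.card_le_card hsub
  have h1 : (B ∪ A ∪ F ∪ M).card ≤ B.card + A.card + F.card + M.card :=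
    (Finset.card_union_le _ _).trans (Nat.add_le_add_right ((Finset.card_union_le _ _).trans
      (Nat.add_le_add_right (Finset.card_union_le _ _) _)) _)
  calc _ ≤ (B.card + t₁.val * n + n * (t₁.val + 2 * δ) + m * X.card) * (2 * t₁.val) := by
        refine Nat.mul_le_mul_right _ (hcard.trans (h1.trans ?_))
        rw [hA, hM]; omega
    _ = (B.card + (2 * t₁.val + 2 * δ) * n) * (2 * t₁.val) + m * (X.card * (2 * t₁.val)) := by ring
    _ ≤ _ := by gcongr

end Soundness

/-! ### The testers -/

/-- When there are few time steps, the whole past at time `0` of a random pair is queried. -/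
theorem exists_querySets_of_small {m n : ℕ} [NeZero n] (hm : 0 < m) :
    ∃ Q : Fin m × ZMod n → Finset (Fin m × ZMod n), (∀ p, (Q p).card ≤ 2 * m + 2) ∧
      ∀ (ε : ℝ) (E : Env m n), IsFar fih ε E → ∃ B : Finset (Fin m × ZMod n),
        (∀ p ∈ B, Rejects fih (Q p) E) ∧ ε * m * n ≤ B.card := by
  classical
  let t₀ : Fin m := ⟨0, hm⟩
  refine ⟨fun p => insert p ((Finset.Icc (-(m : ℤ)) m).image fun j : ℤ => (t₀, p.2 + (j : ZMod n))),
    fun p => ?_, fun ε E hE => ⟨Finset.univ.filter fun p : Fin m × ZMod n =>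
      E p.1 p.2 ≠ step^[p.1.val] (E t₀) p.2, ?_, (hE _ (evolves_iterate (E t₀))).le⟩⟩
  · refine (Finset.card_insert_le _ _).trans (Nat.succ_le_succ (Finset.card_image_le.trans ?_))
    rw [Int.card_Icc]; omega
  · rintro ⟨t, x⟩ hp E' hE'
    rw [Finset.mem_filter] at hp
    by_contra hag
    push Not at hag
    apply hp.2
    have h1 := hag (t, x) (Finset.mem_insert_self _ _)
    simp only at h1 ⊢
    rw [← h1, hE'.eq_iterate (t := t₀) (t' := t) (s := t.val) (by simp [t₀]), iterate_lift_zero,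
      iterate_lift_zero (E t₀)]
    refine iterate_congr fun j hj => ?_
    rw [sub_zero] at hj
    have htlt := t.isLt
    exact hag (t₀, x + (j : ZMod n)) (Finset.mem_insert_of_mem (Finset.mem_image.2
      ⟨j, Finset.mem_Icc.2 (abs_le.1 (by omega)), rfl⟩))

/-- With `t ≤ ε m / 16` and `δ ≤ ε t / 64`, the early and front pairs contribute at most `5 / 16`
and the exceptional locations at most `3 / 8` of the allowance `ε m t n`. Each query set has about
`14 r / δ` elements, and `r / δ ≤ 8192 / ε²`. -/
theorem exists_querySets_of_large {m n : ℕ} [NeZero n] {ε : ℝ} (hε : 0 < ε) (hε1 : ε < 1)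
    (hm : 4096 ≤ ε ^ 2 * m) :
    ∃ Q : Fin m × ZMod n → Finset (Fin m × ZMod n), (∀ p, ((Q p).card : ℝ) ≤ 120000 / ε ^ 2) ∧
      ∀ E : Env m n, IsFar fih ε E → ∃ B : Finset (Fin m × ZMod n),
        (∀ p ∈ B, Rejects fih (Q p) E) ∧ ε / 2 * m * n ≤ B.card := by
  classical
  have hm0 : (0 : ℝ) ≤ m := Nat.cast_nonneg _
  have hεm : 4096 ≤ ε * m := by nlinarith [mul_nonneg hε.le hm0]
  have hm4 : (4096 : ℝ) ≤ m := by nlinarith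
  obtain ⟨a, ha1, ha2⟩ : ∃ a : ℕ, (a : ℝ) ≤ ε * m / 32 ∧ ε * m / 32 < a + 1 :=
    ⟨⌊ε * m / 32⌋₊, Nat.floor_le (by positivity), Nat.lt_floor_add_one _⟩
  -- An even time keeps the alternation in phase with an evolution started at time `0`.
  obtain ⟨t, ht⟩ : ∃ t : ℕ, t = 2 * a := ⟨_, rfl⟩
  have htR : (t : ℝ) = 2 * a := by rw [ht]; push_cast; ring
  have ht1 : (t : ℝ) ≤ ε * m / 16 := by linarith
  have ht2 : ε * m / 32 ≤ t := by linarith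
  have hεt : 128 ≤ ε * t := by nlinarith
  obtain ⟨δ, hδ1, hδ2⟩ : ∃ δ : ℕ, (δ : ℝ) ≤ ε * t / 64 ∧ ε * t / 64 < δ + 1 :=
    ⟨⌊ε * t / 64⌋₊, Nat.floor_le (by positivity), Nat.lt_floor_add_one _⟩
  have hδR : (1 : ℝ) ≤ δ := by
    have : 0 < δ := by
      by_contra h
      have h0 : δ = 0 := by omega
      rw [h0] at hδ2
      norm_num at hδ2
      linarith
    exact_mod_cast this
  have hδpos : 1 ≤ δ := by exact_mod_cast hδR
  have ht0 : (0 : ℝ) < t := by nlinarith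
  have hδt : (δ : ℝ) ≤ t / 64 := by nlinarith
  have htm : (t : ℝ) ≤ m / 16 := by nlinarith
  have hδlow : ε ^ 2 * m / 4096 ≤ δ := by
    have h1 : ε * t / 128 ≤ δ := by linarith
    have h2 : ε * (ε * m / 32) ≤ ε * t := mul_le_mul_of_nonneg_left ht2 hε.le
    have h3 : ε * (ε * m / 32) / 128 = ε ^ 2 * m / 4096 := by ring
    linarith
  have htN : 16 * t ≤ m := by
    have : (16 * t : ℝ) ≤ m := by linarith
    exact_mod_cast this
  have hδN : 64 * δ ≤ t := by
    have : (64 * δ : ℝ) ≤ t := by linarith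
    exact_mod_cast this
  have hmN : 4096 ≤ m := by exact_mod_cast hm4
  let t₁ : Fin m := ⟨t, by omega⟩
  let tl : Fin m := ⟨m - 1, by omega⟩
  -- The window covers the past of any time step, the search for block ends and the gaps of length
  -- `2t` beyond them.
  obtain ⟨r, hr⟩ : ∃ r : ℕ, r = m + 7 * δ + 2 * t + 3 := ⟨_, rfl⟩
  refine ⟨querySet t₁ tl δ r, fun p => ?_, fun E hE => ?_⟩
  · have hcard : ((querySet t₁ tl δ r p).card : ℝ) ≤ 4 + (2 * (r / δ + 1) + 2) * 7 := by
      have h1 : ((querySet t₁ tl δ r p).card : ℝ) ≤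
          ((4 + (2 * (r / δ + 1) + 2) * 7 : ℕ) : ℝ) := by
        exact_mod_cast card_querySet_le t₁ tl hδpos r p
      have h2 : ((r / δ : ℕ) : ℝ) ≤ (r : ℝ) / δ := Nat.cast_div_le
      push_cast at h1
      linarith
    have hr2 : (r : ℝ) ≤ 2 * m := by
      have : r ≤ 2 * m := by omega
      exact_mod_cast this
    have hrδ : (r : ℝ) / δ ≤ 8192 / ε ^ 2 := by
      rw [div_le_div_iff₀ (by linarith) (by positivity)]
      have h1 : (r : ℝ) * ε ^ 2 ≤ 2 * m * ε ^ 2 := by gcongr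
      nlinarith
    have hone : 1 ≤ 1 / ε ^ 2 := by
      rw [le_div_iff₀ (by positivity)]; nlinarith
    have e1 : (8192 : ℝ) / ε ^ 2 = 8192 * (1 / ε ^ 2) := by ring
    have e2 : (120000 : ℝ) / ε ^ 2 = 120000 * (1 / ε ^ 2) := by ring
    rw [e1] at hrδ
    rw [e2]
    linarith
  · let B : Finset (Fin m × ZMod n) :=
      Finset.univ.filter fun p => Rejects fih (querySet t₁ tl δ r p) E
    refine ⟨B, fun p hp => (Finset.mem_filter.1 hp).2, ?_⟩
    have hfar := hE _ (evolves_iterate (interpolate δ (E t₁) (E tl)))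
    have hle := card_ne_le (E := E) (t₁ := t₁) (tl := tl) (r := r) hδpos
      (show δ ≤ t by omega) (show m + 7 * δ + 2 * t + 3 ≤ r by omega)
      (show m - 1 + 1 = m by omega) (show t + 2 * δ ≤ m - 1 by omega)
      (show parity t = false by simp [parity, ht]) B (fun p => by simp [B])
    set N := (Finset.univ.filter fun p : Fin m × ZMod n =>
      E p.1 p.2 ≠ step^[p.1.val] (interpolate δ (E t₁) (E tl)) p.2).card with hN
    have hleR : (N : ℝ) * (2 * t) ≤
        ((B.card : ℝ) + (2 * t + 2 * δ) * n) * (2 * t) + m * ((17 * δ + 7) * n) := by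
      exact_mod_cast hle
    have hn : (0 : ℝ) ≤ n := Nat.cast_nonneg _
    have hfar' : ε * m * n * (2 * t) ≤ N * (2 * t) :=
      mul_le_mul_of_nonneg_right hfar.le (by linarith)
    -- the exceptional pairs are at most a fraction `ε / 2`
    have h1 : (2 * (t : ℝ) + 2 * δ) * (2 * t) + m * (17 * δ + 7) ≤ ε * m * t := by
      have h2 : (2 * (t : ℝ) + 2 * δ) * (2 * t) ≤ (5 / 2 * (ε * m / 16)) * (2 * t) :=
        mul_le_mul_of_nonneg_right (by linarith) (by linarith)
      have h3 : (m : ℝ) * (17 * δ + 7) ≤ m * (24 * (ε * t / 64)) :=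
        mul_le_mul_of_nonneg_left (by linarith) hm0
      have h4 : 0 ≤ ε * m * t := by positivity
      nlinarith
    have h5 : ((2 * (t : ℝ) + 2 * δ) * (2 * t) + m * (17 * δ + 7)) * n ≤ ε * m * t * n :=
      mul_le_mul_of_nonneg_right h1 hn
    have h6 : ε / 2 * m * n * (2 * t) ≤ B.card * (2 * t) := by linarith
    exact le_of_mul_le_mul_right h6 (by linarith)

/-- The threshold `ε² m = 4096` separates the two regimes. Both give `O(1 / ε²)` queries per set,
which is weakened to the cubic bound required by `testable_of_querySets`. -/
theorem exists_querySets {m n : ℕ} [NeZero n] {ε : ℝ} (hε : 0 < ε) (hε1 : ε < 1) :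
    ∃ Q : Fin m × ZMod n → Finset (Fin m × ZMod n), (∀ p, ((Q p).card : ℝ) ≤ 120000 / ε ^ 3) ∧
      ∀ E : Env m n, IsFar fih ε E → ∃ B : Finset (Fin m × ZMod n),
        (∀ p ∈ B, Rejects fih (Q p) E) ∧ ε / 2 * m * n ≤ B.card := by
  have hpow : (120000 : ℝ) / ε ^ 2 ≤ 120000 / ε ^ 3 :=
    div_le_div_of_nonneg_left (by norm_num) (by positivity)
      (pow_le_pow_of_le_one hε.le hε1.le (by norm_num))
  rcases Nat.eq_zero_or_pos m with rfl | hm0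
  · refine ⟨fun _ => ∅, fun p => by simp; positivity, fun E _ => ⟨∅, by simp, by simp⟩⟩
  rcases le_or_gt 4096 (ε ^ 2 * m) with hm | hm
  · obtain ⟨Q, hQ, h⟩ := exists_querySets_of_large (n := n) hε hε1 hm
    exact ⟨Q, fun p => (hQ p).trans hpow, h⟩
  · obtain ⟨Q, hQ, h⟩ := exists_querySets_of_small (n := n) hm0
    refine ⟨Q, fun p => ?_, fun E hE => ?_⟩
    · refine le_trans ?_ hpow
      have h1 : ((Q p).card : ℝ) ≤ 2 * m + 2 := by exact_mod_cast hQ p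
      rw [le_div_iff₀ (by positivity)]
      have h2 : ((Q p).card : ℝ) * ε ^ 2 ≤ (2 * m + 2) * ε ^ 2 := by gcongr
      nlinarith
    · obtain ⟨B, hB, hcard⟩ := h ε E hE
      refine ⟨B, hB, le_trans ?_ hcard⟩
      have : 0 ≤ ε * m * n := by positivity
      linarith

theorem testable_fih : Testable fih :=
  testable_of_querySets (C := 120000) (by norm_num) fun _ _ _ _ hε hε1 => exists_querySets hε hε1

theorem testable_fuh : Testable fuh :=
  testable_of_querySets (C := 120000) (by norm_num) fun _ _ _ _ hε hε1 =>
    let ⟨Q, hQ, h⟩ := exists_querySets hε hε1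
    ⟨Q, hQ, fun _ hE =>
      let ⟨B, hB, hcard⟩ := h _ hE.twist
      ⟨B, fun p hp => (hB p hp).of_twist, hcard⟩⟩

end EvolutionTesting

open EvolutionTesting in
/-- The rules "flip if homogeneous" and "flip unless homogeneous" are not threshold rules, satisfy
the six conditions with non-final patterns `{000, 111}`, and evolution according to each of them is
testable with `O(1/ε⁴)` queries, non-adaptively and with one-sided error. -/
theorem mainTheorem4 :
    (¬ IsThreshold fih ∧ SatisfiesConditions fih 1 homogeneousᶜ ∧ Testable fih) ∧
    (¬ IsThreshold fuh ∧ SatisfiesConditions fuh 1 homogeneousᶜ ∧ Testable fuh) := by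
  exact ⟨⟨not_isThreshold_fih, satisfiesConditions_fih, testable_fih⟩,
    not_isThreshold_fuh, satisfiesConditions_fuh, testable_fuh⟩
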